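/- Let $Q=[0,1]^{\omega}$ be the Hilbert cube with the product of the Lebesgue measures. For a sequence $(d_k)_{k\in\mathbb N}$ in a Banach space, its sum range is the set of all limits of convergent rearrangements $\sum_k d_{\sigma(k)}$, $\sigma$ a permutation of $\mathbb N$. A Kadets family on $Q$ consists of functions $a_m^n$ ($n\ge 1$, $m\in M_n$) and $b_{m,j}^n$ ($n\ge1$, $m\in M_n$, $j\in M_{n+1}$) on $Q$, with $M_n$ finite sets and $|M_n|\to\infty$, such that $\sum_{m\in M_n}a_m^n=1$, $\|a_m^n\|_{L_1}=1/|M_n|$, $a_m^n$ depends only on the coordinate $x_n$ and takes only the values $0$ and $1$, and $b_{m,j}^n=-a_m^n a_j^{n+1}$. Its members occur in the series $\sum_k d_{\sigma(k)}$ in the standard $0$-order if, all other terms being left out, the $a_m^n$ occur lexicographically (by $n$, and for equal $n$ by some linear order of $M_n$, which may depend on $\sigma$) and each $a_m^n$ is immediately followed by the block of all $b_{m,j}^n$, $j\in M_{n+1}$; in the standard $1$-order if the $a_m^n$ occur lexicographically in the same sense, each $a_m^n$ with $n>1$ is immediately followed by the block of all $b_{l,m}^{n-1}$, $l\in M_{n-1}$,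 and the $a_m^1$ are followed by no block. Theorem. For every integer $r>1$ there are $N\ge 1$ and integrable functions $d_k$, $k\in\mathbb N$, on a disjoint union $\Omega=Q_1\cup\dots\cup Q_N$ of $N$ copies of $Q$ such that: (i) the sum range of $(d_k)$ in $L_1(\Omega)$ consists of exactly $r$ points, and these are affinely independent; (ii) there are two disjoint subfamilies $\mathcal F,\mathcal G$ of $(d_k)$ whose restrictions to $Q_N$ are, respectively, the functions $a_m^n$ and $b_{m,j}^n$ of a Kadets family, while all other $d_k$ vanish on $Q_N$; (iii) exactly one point of the sum range equals $1$ on $Q_N$, and all the other points vanish on $Q_N$; (iv) every point of the sum range is the limit of a rearrangement of $\sum_k d_k$ in which $\mathcal F$ and $\mathcal G$ occur in the standard $1$-order if the point equals $1$ on $Q_N$, and in the standard $0$-order otherwise. -/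

import Mathlib

open MeasureTheory Filter Topology

noncomputable section

/-! ### Rearrangements and sum ranges -/

/-- The series `∑ d (σ k)`, the rearrangement of `∑ d k` by the permutation `σ`,
converges to `x`: its partial sums tend to `x`. -/
def RearrangementConvergesTo {E : Type*} [AddCommMonoid E] [TopologicalSpace E]
    (d : ℕ → E) (σ : Equiv.Perm ℕ) (x : E) : Prop :=
  Tendsto (fun K : ℕ => ∑ k ∈ Finset.range K, d (σ k)) atTop (𝓝 x)

/-- The sum range of a series: all limits of its convergent rearrangements. -/
def sumRange {E : Type*} [AddCommMonoid E] [TopologicalSpace E] (d : ℕ → E) : Set E :=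
  {x | ∃ σ : Equiv.Perm ℕ, RearrangementConvergesTo d σ x}

/-! ### Unions of Hilbert cubes -/

/-- The infinite dimensional cube `[0,1]^ω` (coordinates are numbered from `0`). -/
abbrev HilbertCube : Type := ℕ → unitInterval

/-- The product measure on the cube, every factor carrying Lebesgue measure. -/
def cubeMeasure : Measure HilbertCube :=
  Measure.infinitePi fun _ : ℕ => (volume : Measure unitInterval)

/-- The disjoint union of the `N + 1` cubes `Q_0, …, Q_N`; the point `(i, x)` is the point `x`
of the cube `Q_i`. -/
abbrev CubeUnion (N : ℕ) : Type := Fin (N + 1) × HilbertCube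

/-- The measure on the union of cubes whose restriction to every cube is the product measure. -/
def cubeUnionMeasure (N : ℕ) : Measure (CubeUnion N) :=
  (Measure.count : Measure (Fin (N + 1))).prod cubeMeasure

/-! ### Kadets families -/

/-- The Kadets properties of the functions `a n m` (`m ∈ M n`) and `b n m j`
(`m ∈ M n`, `j ∈ M (n + 1)`) on the cube. -/
structure IsKadetsFamily (M : ℕ → Type) [∀ n, Fintype (M n)]
    (a : ∀ n, M n → HilbertCube → ℝ)
    (b : ∀ n, M n → M (n + 1) → HilbertCube → ℝ) : Prop where
  integrable : ∀ n m, Integrable (a n m) cubeMeasure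
  sum_eq_one : ∀ n x, ∑ m, a n m x = 1
  norm_eq : ∀ n m, ∫ x, |a n m x| ∂cubeMeasure = 1 / (Fintype.card (M n) : ℝ)
  card_tendsto : Tendsto (fun n => Fintype.card (M n)) atTop atTop
  depends_only : ∀ n m (x y : HilbertCube), x n = y n → a n m x = a n m y
  zero_or_one : ∀ n m x, a n m x = 0 ∨ a n m x = 1
  b_eq : ∀ n m j x, b n m j x = -(a n m x * a (n + 1) j x)

/-- The indices of the functions `a n m` of a Kadets family. -/
abbrev AIndex (M : ℕ → Type) : Type := Σ n, M n

/-- The indices of the functions `b n m j` of a Kadets family. -/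
abbrev BIndex (M : ℕ → Type) : Type := Σ n, M n × M (n + 1)

/-- `posA` and `posB` give the places which the members of a Kadets family occupy in a series.
The functions `a` appear in lexicographic order, for some linear orders of the finite sets `M n`,
and every function `b` appears after the function `a` with index `lead b` and before all later
functions `a`. So, with the other terms of the series left out, every `a` is immediately followed
by the block of all `b` which it leads. -/
def IsBlockArranged (M : ℕ → Type) (lead : BIndex M → AIndex M)
    (posA : AIndex M → ℕ) (posB : BIndex M → ℕ) : Prop :=
  (∃ ord : ∀ n, LinearOrder (M n), ∀ p q : AIndex M,
      posA p < posA q ↔ Sigma.Lex (· < ·) (fun n => (ord n).lt) p q) ∧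
  ∀ s : BIndex M, posA (lead s) < posB s ∧
    ∀ p : AIndex M, posA (lead s) < posA p → posB s < posA p

/-- The standard arrangement of a Kadets family with sum `0`:
`a n m` is followed by all `b n m j`, `j ∈ M (n + 1)`. -/
def IsZeroArranged (M : ℕ → Type) (posA : AIndex M → ℕ) (posB : BIndex M → ℕ) : Prop :=
  IsBlockArranged M (fun s => ⟨s.1, s.2.1⟩) posA posB

/-- The standard arrangement of a Kadets family with sum `1`:
`a (n + 1) j` is followed by all `b n m j`, `m ∈ M n`, and the `a 0 m` are followed by nothing. -/
def IsOneArranged (M : ℕ → Type) (posA : AIndex M → ℕ) (posB : BIndex M → ℕ) : Prop :=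
  IsBlockArranged M (fun s => ⟨s.1 + 1, s.2.2⟩) posA posB

end

/-! Write `r = s + 1`. Each cube `i.succ` carries its own Kadets family, the `i`-th one, with `n +
1` cells at level `n`, and cube `0` couples the families. On cube `0` the function `a n m` is `-1`
times the indicator of "digit `n` is `m`" for the last family and the constant `-1/(n+1)` for every
other family; `b n m k` is the indicator of "digit `n+1` is `k`" divided by `n+1`. A single family
can be summed to `0` or to `1`; the coupling cube forces exactly one family to have sum `1`. The
limits are therefore the vectors `limitValue i₀`: `1` on the cube of family `i₀`, `0` on the other
family cubes, `-1` on cube `0`.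

All these limits occur. Put family `i₀` in the `1`-order, the others in the `0`-order, and group all
families by the cell `(n, m)` of the leading `a`. Every block sums to zero on every cube except the
single block of level `0` (`sum_block_term`), and the sum of the norms in a block is `O(1/n)`, so
the series converges.

There are no other limits. A limit is constant on each cube: an early partial sum depends on low
digits only, a much later one on high digits only (up to a constant), and both are close to the
limit (`exists_integral_sub_const_le`). It remains to determine these constants. Fix a level `j`
beyond everything used at a late time `K₀`, and follow the series until all functions up to level `j
+ 1` have appeared. On a family cube the partial sum is a function of the digits up to `j`, minus
the `0`-`1` matrix `hasB` recording which `b j m k` are present, plus a function of the later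
digits. As this is nearly constant, `hasB` is nearly additive, and a nearly additive `0`-`1` matrix
hardly depends on one of its indices (`rowOscillation_mul_le`); since the matrix grows from `0` to
`1` in small steps, it is the same index all the time (`rowOscillation_dichotomy`). If the row index
is irrelevant, the left part of the sum is a nearly constant integer-valued function moving in small
steps, hence stays near one integer; it starts at the limit and ends at `1`. If the column index is
irrelevant, the same applies to the left part minus `hasB`, which ends at `1 - 1 = 0`.

On the coupling cube, the part depending on digit `j + 1` is the sum over the families of the column
means of `hasB`, minus the indicator of the presence of `a (j+1) k` of the last family. Families of
the second kind contribute almost nothing that depends on `k`, and for those of the first kind the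
mean is close to the matrix itself. So the sum of the matrices of the first kind minus that
indicator is again integer-valued, nearly constant and slowly moving; it starts at `0` and ends at
(number of families of the first kind) `- 1`. Hence there is exactly one such family
(`IsWindow.card_eq_one`). -/

open scoped BigOperators

/-! ### Nearly additive 0-1 matrices and slowly moving integer-valued functions. -/

section FiniteAverages

variable {α β : Type*} [Fintype α] [Fintype β]

/-- The mean oscillation of a matrix along its columns; it is small if the entry hardly depends on
the row index. -/
noncomputable def rowOscillation (v : α → β → ℝ) : ℝ :=
  𝔼 m, 𝔼 m', 𝔼 k, |v m k - v m' k|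

/-- The mean deviation of a matrix from the sums of a function of the row index and a function
of the column index. -/
noncomputable def additivityDefect (v : α → β → ℝ) : ℝ :=
  𝔼 m, 𝔼 m', 𝔼 k, 𝔼 k', |v m k - v m' k - v m k' + v m' k'|

/-- The left side is nonzero only if `b = c = 1 - a`; then `a - b - c` is `1` or `-2`, and adding
`d` leaves absolute value at least `1`. -/
lemma mul_abs_sub_le {a b c d : ℝ} (ha : a = 0 ∨ a = 1) (hb : b = 0 ∨ b = 1)
    (hc : c = 0 ∨ c = 1) (hd : d = 0 ∨ d = 1) :
    |a - b| * |a - c| ≤ |a - b - c + d| := by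
  rcases ha with rfl | rfl <;> rcases hb with rfl | rfl <;> rcases hc with rfl | rfl <;>
    rcases hd with rfl | rfl <;> norm_num

lemma abs_sub_le_one {a b : ℝ} (ha : a = 0 ∨ a = 1) (hb : b = 0 ∨ b = 1) : |a - b| ≤ 1 := by
  rcases ha with rfl | rfl <;> rcases hb with rfl | rfl <;> norm_num

lemma expect_abs_sub_le {ι : Type*} [Fintype ι] (f g h : ι → ℝ) :
    𝔼 i, |f i - h i| ≤ 𝔼 i, |f i - g i| + 𝔼 i, |g i - h i| := by
  rw [← Finset.expect_add_distrib]
  exact Finset.expect_le_expect fun i _ => abs_sub_le _ _ _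

/-- A `0`-`1` matrix which is nearly additive hardly depends on one of its indices. -/
theorem rowOscillation_mul_le [Nonempty α] [Nonempty β] (v : α → β → ℝ) (hv : ∀ m k, v m k = 0 ∨ v m k = 1) :
    rowOscillation v * rowOscillation (fun k m => v m k) ≤ 3 * additivityDefect v := by
  -- The two differences are moved to a common corner `(m, k)` of the rectangle `m, m', k, k'`: the
  -- first to column `k`, the second to row `m`, each at the cost of one mixed difference. On the
  -- rectangle `mul_abs_sub_le` applies. This gives the three defects.
  have key : ∀ m m' m'' k k' k'', |v m k'' - v m' k''| * |v m'' k - v m'' k'| ≤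
      |v m k - v m' k - v m k' + v m' k'| + |v m k'' - v m' k'' - v m k + v m' k|
        + |v m k - v m'' k - v m k' + v m'' k'| := by
    intro m m' m'' k k' k''
    have h1 : |v m k'' - v m' k''| ≤ |v m k - v m' k| + |v m k'' - v m' k'' - v m k + v m' k| := by
      have := abs_add_le (v m k - v m' k) (v m k'' - v m' k'' - v m k + v m' k)
      rwa [show v m k - v m' k + (v m k'' - v m' k'' - v m k + v m' k) = v m k'' - v m' k''
        by ring] at this
    have h2 : |v m'' k - v m'' k'| ≤ |v m k - v m k'| + |v m k - v m'' k - v m k' + v m'' k'| := by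
      have := abs_sub (v m k - v m k') (v m k - v m'' k - v m k' + v m'' k')
      rwa [show v m k - v m k' - (v m k - v m'' k - v m k' + v m'' k') = v m'' k - v m'' k'
        by ring] at this
    have h3 := mul_abs_sub_le (hv m k) (hv m' k) (hv m k') (hv m' k')
    have h4 := abs_sub_le_one (hv m k) (hv m' k)
    have h5 := abs_sub_le_one (hv m'' k) (hv m'' k')
    have h6 := abs_nonneg (v m k - v m' k)
    nlinarith [mul_le_mul_of_nonneg_right h1 (abs_nonneg (v m'' k - v m'' k')),
      mul_le_mul_of_nonneg_left h2 h6, mul_le_mul_of_nonneg_left h5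
        (abs_nonneg (v m k'' - v m' k'' - v m k + v m' k)),
      mul_le_mul_of_nonneg_right h4 (abs_nonneg (v m k - v m'' k - v m k' + v m'' k'))]
  have e : rowOscillation v * rowOscillation (fun k m => v m k) =
      𝔼 m, 𝔼 m', 𝔼 k'', 𝔼 k, 𝔼 k', 𝔼 m'', |v m k'' - v m' k''| * |v m'' k - v m'' k'| := by
    simp only [rowOscillation, Finset.expect_mul]
    simp only [Finset.mul_expect]
  rw [e]
  calc _ ≤ 𝔼 m, 𝔼 m', 𝔼 k'' : β, 𝔼 k, 𝔼 k', 𝔼 m'',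
        (|v m k - v m' k - v m k' + v m' k'| + |v m k'' - v m' k'' - v m k + v m' k|
        + |v m k - v m'' k - v m k' + v m'' k'|) := by
        iterate 6 refine Finset.expect_le_expect fun _ _ => ?_
        exact key _ _ _ _ _ _
    _ = additivityDefect v + additivityDefect v + additivityDefect v := by
        simp only [Finset.expect_add_distrib, Fintype.expect_const]
        congr 1
        rw [additivityDefect]
        refine Finset.expect_congr rfl fun m _ => ?_
        symm
        rw [Finset.expect_comm Finset.univ Finset.univ]
        refine Finset.expect_congr rfl fun k _ => ?_
        rw [Finset.expect_comm]
    _ = _ := by ring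

/-- If the smaller of two `0`-`1` matrices hardly depends on the row index and the larger one hardly
depends on the column index, then the smaller one is nearly zero or the larger one nearly one. -/
theorem expect_mul_one_sub_expect_le [Nonempty α] [Nonempty β] (v w : α → β → ℝ) (hv : ∀ m k, v m k = 0 ∨ v m k = 1)
    (hw : ∀ m k, w m k = 0 ∨ w m k = 1) (hvw : ∀ m k, v m k ≤ w m k) :
    (𝔼 m, 𝔼 k, v m k) * (1 - 𝔼 m, 𝔼 k, w m k) ≤
      rowOscillation v + rowOscillation (fun k m => w m k) := by
  have e : (𝔼 m, 𝔼 k, v m k) * (1 - 𝔼 m, 𝔼 k, w m k) =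
      𝔼 m', 𝔼 k, 𝔼 m, 𝔼 k', v m' k * (1 - w m k') := by
    have : (1 - 𝔼 m, 𝔼 k, w m k) = 𝔼 m, 𝔼 k, (1 - w m k) := by
      simp [Finset.expect_sub_distrib]
    rw [this]
    simp only [Finset.expect_mul]
    simp only [Finset.mul_expect]
  -- If `v m' k = 1` and `w m k' = 0`, then `v m k ≤ w m k` excludes that both `v m k = 1` and `w m
  -- k = 0`, so one of the two differences is `1`.
  have key : ∀ m' k m k', v m' k * (1 - w m k') ≤ |v m' k - v m k| + |w m k - w m k'| := by
    intro m' k m k'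
    have h := hvw m k
    rcases hv m' k with h1 | h1 <;> rcases hv m k with h2 | h2 <;>
      rcases hw m k with h3 | h3 <;> rcases hw m k' with h4 | h4 <;>
      rw [h2, h3] at h <;> rw [h1, h2, h3, h4] <;> (revert h; norm_num)
  rw [e]
  calc _ ≤ 𝔼 m', 𝔼 k, 𝔼 m, 𝔼 k', (|v m' k - v m k| + |w m k - w m k'|) := by
        iterate 4 refine Finset.expect_le_expect fun _ _ => ?_
        exact key _ _ _ _
    _ = _ := by
        simp only [Finset.expect_add_distrib, Fintype.expect_const, rowOscillation]
        congr 1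
        · refine Finset.expect_congr rfl fun m _ => ?_
          rw [Finset.expect_comm]
        · refine Finset.expect_congr rfl fun k _ => ?_
          rw [Finset.expect_comm]

lemma rowOscillation_le_add [Nonempty α] [Nonempty β] (v w : α → β → ℝ) :
    rowOscillation w ≤ rowOscillation v + 2 * 𝔼 m, 𝔼 k, |v m k - w m k| := by
  have key : ∀ m m' k, |w m k - w m' k| ≤
      |v m k - v m' k| + (|v m k - w m k| + |v m' k - w m' k|) := by
    intro m m' k
    have h1 := abs_sub_le (w m k) (v m k) (w m' k)
    have h2 := abs_sub_le (v m k) (v m' k) (w m' k)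
    rw [abs_sub_comm (w m k) (v m k)] at h1
    linarith
  calc _ ≤ 𝔼 m, 𝔼 m', 𝔼 k, (|v m k - v m' k| + (|v m k - w m k| + |v m' k - w m' k|)) := by
        rw [rowOscillation]
        iterate 3 refine Finset.expect_le_expect fun _ _ => ?_
        exact key _ _ _
    _ = _ := by
        simp only [Finset.expect_add_distrib, Fintype.expect_const, rowOscillation]
        ring

/-- An integer-valued function with small mean oscillation which moves in small steps
stays close to the same integer constant. -/
theorem eq_of_small_oscillation {Ω : Type*} [Fintype Ω] [Nonempty Ω] (φ : ℕ → Ω → ℝ)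
    (hint : ∀ K x, ∃ z : ℤ, φ K x = z) {K₀ K₁ : ℕ} (hK : K₀ ≤ K₁) {c c' : ℤ} {η : ℝ}
    (hη : η ≤ 1 / 8)
    (hosc : ∀ K, K₀ ≤ K → K ≤ K₁ → 𝔼 x, 𝔼 x', |φ K x - φ K x'| ≤ η)
    (hstep : ∀ K, K₀ ≤ K → K < K₁ → 𝔼 x, |φ (K + 1) x - φ K x| ≤ η)
    (hstart : 𝔼 x, |φ K₀ x - c| ≤ η) (hend : 𝔼 x, |φ K₁ x - c'| ≤ η) : c = c' := by
  -- Bootstrap: the distance `D` to `c` satisfies `D * (1 - D) ≤ η`, so `D ≤ 3η ≤ 3/8` improves to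
  -- `D ≤ 2η`. A step adds at most `η`, which keeps the induction going.
  have improve : ∀ K, K₀ ≤ K → K ≤ K₁ → 𝔼 x, |φ K x - c| ≤ 3 * η →
      𝔼 x, |φ K x - c| ≤ 2 * η := by
    intro K h0 h1 h
    -- Integrality enters here: if `φ K x'` differs from `c`, it does so by at least `1` and the
    -- left side is not positive.
    have key : ∀ x x', |φ K x - c| * (1 - |φ K x' - c|) ≤ |φ K x - φ K x'| := by
      intro x x'
      by_cases hx : φ K x' = c
      · simp [hx]
      · have : 1 ≤ |φ K x' - c| := by
          obtain ⟨z, hz⟩ := hint K x'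
          rw [hz] at hx ⊢
          have : z - c ≠ 0 := fun h => hx (by exact_mod_cast sub_eq_zero.1 h)
          exact_mod_cast Int.one_le_abs this
        nlinarith [abs_nonneg (φ K x - c), abs_nonneg (φ K x - φ K x')]
    have h2 : (𝔼 x, |φ K x - c|) * (1 - 𝔼 x, |φ K x - c|) ≤ η := by
      refine le_trans (le_of_eq ?_) (le_trans
        (Finset.expect_le_expect fun x _ => Finset.expect_le_expect fun x' _ => key x x')
        (hosc K h0 h1))
      have : (1 - 𝔼 x, |φ K x - c|) = 𝔼 x, (1 - |φ K x - c|) := by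
        simp [Finset.expect_sub_distrib]
      rw [this, Finset.expect_mul]
      simp only [Finset.mul_expect]
    have h3 : 0 ≤ 𝔼 x, |φ K x - c| := Finset.expect_nonneg fun _ _ => abs_nonneg _
    nlinarith
  have hη0 : 0 ≤ η := le_trans (Finset.expect_nonneg fun _ _ => abs_nonneg _) hstart
  have main : ∀ K, K₀ ≤ K → K ≤ K₁ → 𝔼 x, |φ K x - c| ≤ 2 * η := by
    intro K h0
    induction K, h0 using Nat.le_induction with
    | base => intro _; linarith
    | succ K h0 ih =>
      intro h1
      refine improve (K + 1) (by omega) h1 ?_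
      have := expect_abs_sub_le (φ (K + 1)) (φ K) (fun _ => (c : ℝ))
      have := hstep K h0 (by omega)
      have := ih (by omega)
      linarith
  have h1 := main K₁ hK le_rfl
  have h2 := expect_abs_sub_le (fun _ => (c : ℝ)) (φ K₁) (fun _ => (c' : ℝ))
  simp only [Fintype.expect_const] at h2
  simp_rw [abs_sub_comm (c : ℝ)] at h2
  have h3 : |(c' : ℝ) - c| < 1 := by rw [abs_sub_comm]; rw [abs_sub_comm] at h2; linarith
  have h4 : |c' - c| < 1 := by exact_mod_cast h3
  have := Int.abs_lt_one_iff.1 h4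
  omega

/-- At the intermediate time `T` the column index is irrelevant. If at time `K` it were the row
index instead, comparing the monotone matrices through `expect_mul_one_sub_expect_le` gives `2t` as
a bound for a product with one factor at least `1/4`. So the matrix at time `K` is within `8t` of
all zeros (`K ≤ T`) or all ones (`T ≤ K`), and its oscillation is at most `16t` anyway. -/
lemma rowOscillation_le_of_le [Nonempty α] [Nonempty β] (v : ℕ → α → β → ℝ)
    (hv : ∀ K m k, v K m k = 0 ∨ v K m k = 1) {K₀ K₁ T : ℕ}
    (hmono : ∀ K L, K ≤ L → ∀ m k, v K m k ≤ v L m k) {t : ℝ} (ht : 0 < t)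
    (hprod : ∀ K, K₀ ≤ K → K ≤ K₁ →
      rowOscillation (v K) * rowOscillation (fun k m => v K m k) ≤ t ^ 2)
    (hT0 : 1 / 4 ≤ 𝔼 m, 𝔼 k, v T m k) (hT1 : 𝔼 m, 𝔼 k, v T m k ≤ 3 / 4)
    (hT : rowOscillation (fun k m => v T m k) ≤ t) (K : ℕ) (h0 : K₀ ≤ K) (h1 : K ≤ K₁) :
    rowOscillation (fun k m => v K m k) ≤ 16 * t := by
  by_cases hc : rowOscillation (fun k m => v K m k) ≤ t
  · linarith
  have hr : rowOscillation (v K) ≤ t := by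
    by_contra h
    push Not at h hc
    nlinarith [hprod K h0 h1]
  rcases le_total K T with hKT | hKT
  · have h2 := expect_mul_one_sub_expect_le (v K) (v T) (hv K) (hv T) (hmono K T hKT)
    have h3 := rowOscillation_le_add (fun _ _ => 0) (fun k m => v K m k)
    have h4 : 𝔼 k, 𝔼 m, |0 - v K m k| = 𝔼 m, 𝔼 k, v K m k := by
      rw [Finset.expect_comm]
      refine Finset.expect_congr rfl fun m _ => Finset.expect_congr rfl fun k _ => ?_
      rcases hv K m k with h | h <;> simp [h]
    have h5 : rowOscillation (fun (_ : β) (_ : α) => (0 : ℝ)) = 0 := by simp [rowOscillation]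
    have h6 : 0 ≤ 𝔼 m, 𝔼 k, v K m k := Finset.expect_nonneg fun m _ =>
      Finset.expect_nonneg fun k _ => by rcases hv K m k with h | h <;> simp [h]
    rw [h4, h5] at h3
    nlinarith
  · have h2 := expect_mul_one_sub_expect_le (fun k m => v T m k) (fun k m => v K m k)
      (fun k m => hv T m k) (fun k m => hv K m k) (fun k m => hmono T K hKT m k)
    have h3 := rowOscillation_le_add (fun _ _ => 1) (fun k m => v K m k)
    have h4 : 𝔼 k, 𝔼 m, |1 - v K m k| = 1 - 𝔼 k, 𝔼 m, v K m k := by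
      have : 1 - 𝔼 k, 𝔼 m, v K m k = 𝔼 k, 𝔼 m, (1 - v K m k) := by
        simp [Finset.expect_sub_distrib]
      rw [this]
      refine Finset.expect_congr rfl fun m _ => Finset.expect_congr rfl fun k _ => ?_
      rcases hv K k m with h | h <;> simp [h]
    have h5 : rowOscillation (fun (_ : β) (_ : α) => (1 : ℝ)) = 0 := by simp [rowOscillation]
    have h6 : 0 ≤ 1 - 𝔼 k, 𝔼 m, v K m k := by
      rw [← h4]
      exact Finset.expect_nonneg fun m _ => Finset.expect_nonneg fun k _ => abs_nonneg _
    rw [h4, h5] at h3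
    rw [Finset.expect_comm] at hT0
    nlinarith

/-- An increasing family of nearly additive `0`-`1` matrices which grows from zero to one in small
steps hardly depends on one index, and on the same one at all times. -/
theorem rowOscillation_dichotomy [Nonempty α] [Nonempty β] (v : ℕ → α → β → ℝ) (hv : ∀ K m k, v K m k = 0 ∨ v K m k = 1)
    {K₀ K₁ : ℕ} (hK : K₀ ≤ K₁) (hmono : ∀ K L, K ≤ L → ∀ m k, v K m k ≤ v L m k)
    (h0 : ∀ m k, v K₀ m k = 0) (h1 : ∀ m k, v K₁ m k = 1)
    (hstep : ∀ K, K₀ ≤ K → K < K₁ → 𝔼 m, 𝔼 k, |v (K + 1) m k - v K m k| ≤ 1 / 4)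
    {t : ℝ} (ht : 0 < t)
    (hdef : ∀ K, K₀ ≤ K → K ≤ K₁ → 3 * additivityDefect (v K) ≤ t ^ 2) :
    (∀ K, K₀ ≤ K → K ≤ K₁ → rowOscillation (v K) ≤ 16 * t) ∨
      (∀ K, K₀ ≤ K → K ≤ K₁ → rowOscillation (fun k m => v K m k) ≤ 16 * t) := by
  have hprod : ∀ K, K₀ ≤ K → K ≤ K₁ →
      rowOscillation (v K) * rowOscillation (fun k m => v K m k) ≤ t ^ 2 := fun K h0 h1 =>
    (rowOscillation_mul_le (v K) (hv K)).trans (hdef K h0 h1)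
  -- The first time at which the mean reaches `1/2`; steps of at most `1/4` keep it below `3/4`.
  -- There the matrix is far from both constants, so the irrelevant index at `T` decides for all
  -- times.
  obtain ⟨T, hT0, hT1, hT2, hT3⟩ : ∃ T, K₀ ≤ T ∧ T ≤ K₁ ∧ 1 / 4 ≤ 𝔼 m, 𝔼 k, v T m k ∧
      𝔼 m, 𝔼 k, v T m k ≤ 3 / 4 := by
    have hex : ∃ T, K₀ ≤ T ∧ 1 / 2 ≤ 𝔼 m, 𝔼 k, v T m k :=
      ⟨K₁, hK, by simp only [h1, Fintype.expect_const]; norm_num⟩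
    classical
    obtain ⟨hf0, hf1⟩ := Nat.find_spec hex
    have hf2 : Nat.find hex ≤ K₁ := Nat.find_min' hex
      ⟨hK, by simp only [h1, Fintype.expect_const]; norm_num⟩
    refine ⟨Nat.find hex, hf0, hf2, by linarith, ?_⟩
    rcases hf0.eq_or_lt with h | h
    · rw [← h]
      simp only [h0, Fintype.expect_const]
      norm_num
    · obtain ⟨T, hT⟩ : ∃ T, Nat.find hex = T + 1 := ⟨Nat.find hex - 1, by omega⟩
      have h2 := Nat.find_min hex (m := T) (by omega)
      rw [hT] at hf0 hf1 hf2 h ⊢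
      have h3 : 𝔼 m, 𝔼 k, v T m k < 1 / 2 := by
        by_contra h4
        exact h2 ⟨by omega, not_lt.1 h4⟩
      have h4 := hstep T (by omega) (by omega)
      have h5 : 𝔼 m, 𝔼 k, v (T + 1) m k ≤
          𝔼 m, 𝔼 k, |v (T + 1) m k - v T m k| + 𝔼 m, 𝔼 k, v T m k := by
        simp only [← Finset.expect_add_distrib]
        refine Finset.expect_le_expect fun m _ => Finset.expect_le_expect fun k _ => ?_
        linarith [le_abs_self (v (T + 1) m k - v T m k)]
      linarith
  by_cases hc : rowOscillation (fun k m => v T m k) ≤ t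
  · right
    exact rowOscillation_le_of_le v hv hmono ht hprod hT2 hT3 hc
  · left
    have hr : rowOscillation (v T) ≤ t := by
      by_contra h
      push Not at h hc
      nlinarith [hprod T hT0 hT1]
    rw [Finset.expect_comm] at hT2 hT3
    exact rowOscillation_le_of_le (fun K k m => v K m k) (fun K k m => hv K m k)
      (fun K L h k m => hmono K L h m k) ht
      (fun K h0 h1 => by rw [mul_comm]; exact hprod K h0 h1) hT2 hT3 hr

end FiniteAverages

/-! ### Uniformly distributed digit words: resampling and splicing. -/

section Words

/-- Sequences of digits, the `n`-th digit being less than `n + 1`. -/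
abbrev Digits : Type := ∀ n : ℕ, Fin (n + 1)

/-- Digit sequences of length `J`. -/
abbrev Word (J : ℕ) : Type := ∀ n : Fin J, Fin ((n : ℕ) + 1)

/-- The infinite digit sequence obtained from a word by adding zeros. -/
def Word.extend {J : ℕ} (y : Word J) : Digits := fun n => if h : n < J then y ⟨n, h⟩ else 0

/-- The sequence which agrees with `x` up to the place `j` and with `x'` afterwards. -/
def Digits.splice (j : ℕ) (x x' : Digits) : Digits := fun n => if n ≤ j then x n else x' n

variable {J : ℕ}

lemma Word.extend_update (y : Word J) {j : ℕ} (hj : j < J) (m : Fin (j + 1)) :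
    Word.extend (Function.update y ⟨j, hj⟩ m) = Function.update y.extend j m := by
  funext n
  by_cases hn : n = j
  · subst hn
    simp [Word.extend, hj]
  · rw [Function.update_of_ne hn]
    unfold Word.extend
    split_ifs with h
    · rw [Function.update_of_ne]
      simpa [Fin.ext_iff] using hn
    · rfl

/-- Exchanging digit `j` of the word with the independently drawn digit is an involution of the
pairs, so resampling a digit preserves the uniform distribution. -/
lemma Word.expect_update (h : Digits → ℝ) {j : ℕ} (hj : j < J) :
    𝔼 y : Word J, 𝔼 m, h (Function.update y.extend j m) = 𝔼 y : Word J, h y.extend := by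
  let e : Word J × Fin (j + 1) → Word J × Fin (j + 1) :=
    fun p => (Function.update p.1 ⟨j, hj⟩ p.2, p.1 ⟨j, hj⟩)
  have he : Function.Involutive e := by
    rintro ⟨y, m⟩
    simp [e]
  have h1 : 𝔼 p : Word J × Fin (j + 1), h (e p).1.extend =
      𝔼 p : Word J × Fin (j + 1), h p.1.extend :=
    Fintype.expect_equiv he.toPerm _ _ fun p => rfl
  rw [← Finset.univ_product_univ, Finset.expect_product, Finset.expect_product] at h1
  simpa [e, Word.extend_update] using h1

/-- Exchanging the tails of two independent words is an involution of the pairs. -/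
lemma Word.expect_splice (h : Digits → ℝ) (j : ℕ) :
    𝔼 x : Word J, 𝔼 x' : Word J, h (Digits.splice j x.extend x'.extend) =
      𝔼 y : Word J, h y.extend := by
  let w : Word J → Word J → Word J := fun x x' n => if (n : ℕ) ≤ j then x n else x' n
  let e : Word J × Word J → Word J × Word J := fun p => (w p.1 p.2, w p.2 p.1)
  have he : Function.Involutive e := by
    rintro ⟨x, x'⟩
    ext n
    · simp only [e, w]; split_ifs <;> rfl
    · simp only [e, w]; split_ifs <;> rfl
  have hw : ∀ x x', (w x x').extend = Digits.splice j x.extend x'.extend := by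
    intro x x'
    funext n
    simp only [Word.extend, Digits.splice, w]
    split_ifs <;> rfl
  have h1 : 𝔼 p : Word J × Word J, h (e p).1.extend =
      𝔼 p : Word J × Word J, h p.1.extend :=
    Fintype.expect_equiv he.toPerm _ _ fun p => rfl
  rw [← Finset.univ_product_univ, Finset.expect_product, Finset.expect_product] at h1
  simpa [e, hw] using h1

lemma Word.expect_digit {j : ℕ} (hj : j < J) (h : Fin (j + 1) → ℝ) :
    𝔼 y : Word J, h (y.extend j) = 𝔼 m, h m := by
  rw [← Word.expect_update (fun y => h (y j)) hj]
  simp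

lemma Word.expect_update₂ (h : Digits → ℝ) {j : ℕ} (hj : j + 1 < J) :
    𝔼 y : Word J, 𝔼 m, 𝔼 k, h (Function.update (Function.update y.extend j m) (j + 1) k) =
      𝔼 y : Word J, h y.extend := by
  rw [← Word.expect_update h hj, ← Word.expect_update (fun y => 𝔼 k, h (Function.update y (j + 1) k))
    (by omega : j < J)]

lemma Word.expect_digit₂ {j : ℕ} (hj : j + 1 < J) (h : Fin (j + 1) → Fin (j + 2) → ℝ) :
    𝔼 y : Word J, h (y.extend j) (y.extend (j + 1)) = 𝔼 m, 𝔼 k, h m k := by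
  rw [← Word.expect_update₂ (fun y => h (y j) (y (j + 1))) hj]
  simp

end Words

/-! ### The functions of the series and the decomposition of partial sums at a level. -/

section Terms

/-- The index sets of the Kadets families: `n + 1` functions at the level `n`. -/
abbrev Cell (n : ℕ) : Type := Fin (n + 1)

/-- Indices of the members of `s + 1` Kadets families. -/
abbrev FamilyIndex (s : ℕ) : Type := Fin (s + 1) × (AIndex Cell ⊕ BIndex Cell)

/-- The indicator of the event that the `n`-th digit is `m`. -/
noncomputable def digitIndicator (n : ℕ) (m : Fin (n + 1)) (y : Digits) : ℝ :=
  if y n = m then 1 else 0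

/-- The values of the functions of the series on the cube `0`, which couples the families. -/
noncomputable def couplingTerm {s : ℕ} : FamilyIndex s → Digits → ℝ
  | (i, .inl ⟨n, m⟩), y => if i = Fin.last s then -digitIndicator n m y else -(1 / ((n : ℝ) + 1))
  | (_, .inr ⟨n, (_, k)⟩), y => digitIndicator (n + 1) k y / ((n : ℝ) + 1)

/-- The members of a Kadets family. -/
noncomputable def kadetsTerm : AIndex Cell ⊕ BIndex Cell → Digits → ℝ
  | .inl ⟨n, m⟩, y => digitIndicator n m y
  | .inr ⟨n, (m, k)⟩, y => -(digitIndicator n m y * digitIndicator (n + 1) k y)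

/-- The functions of the series on the cube `q`. The cube `i + 1` carries the `i`-th family. -/
noncomputable def term {s : ℕ} (p : FamilyIndex s) (q : Fin (s + 2)) (y : Digits) : ℝ :=
  Fin.cases (couplingTerm p y) (fun i => if i = p.1 then kadetsTerm p.2 y else 0) q

/-- The first digit on which a member of a family depends. -/
def firstLevel : AIndex Cell ⊕ BIndex Cell → ℕ
  | .inl p => p.1
  | .inr p => p.1

/-- The last digit on which a member of a family depends. -/
def lastLevel : AIndex Cell ⊕ BIndex Cell → ℕ
  | .inl p => p.1
  | .inr p => p.1 + 1

variable {s : ℕ}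

@[simp] lemma term_zero (p : FamilyIndex s) (y : Digits) : term p 0 y = couplingTerm p y := rfl

@[simp] lemma term_succ (p : FamilyIndex s) (i : Fin (s + 1)) (y : Digits) :
    term p i.succ y = if i = p.1 then kadetsTerm p.2 y else 0 := rfl

lemma firstLevel_le_lastLevel (p : AIndex Cell ⊕ BIndex Cell) : firstLevel p ≤ lastLevel p := by
  rcases p with p | p <;> simp [firstLevel, lastLevel]

lemma term_congr (p : FamilyIndex s) (q : Fin (s + 2)) {y y' : Digits}
    (h : ∀ n, firstLevel p.2 ≤ n → n ≤ lastLevel p.2 → y n = y' n) : term p q y = term p q y' := by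
  obtain ⟨i, ⟨n, m⟩ | ⟨n, m, k⟩⟩ := p
  · have h1 := h n le_rfl le_rfl
    refine Fin.cases ?_ (fun i => ?_) q
    · simp [couplingTerm, digitIndicator, h1]
    · simp [kadetsTerm, digitIndicator, h1]
  · have h1 := h n le_rfl (Nat.le_succ n)
    have h2 := h (n + 1) (Nat.le_succ n) le_rfl
    refine Fin.cases ?_ (fun i => ?_) q
    · simp [couplingTerm, digitIndicator, h2]
    · simp [kadetsTerm, digitIndicator, h1, h2]

/-- The sum of the functions with indices in `U`, on the cube `q`. -/
noncomputable def partialSum (U : Finset (FamilyIndex s)) (q : Fin (s + 2)) (y : Digits) : ℝ :=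
  ∑ p ∈ U, term p q y

lemma partialSum_congr (U : Finset (FamilyIndex s)) (q : Fin (s + 2)) {y y' : Digits}
    (h : ∀ p ∈ U, ∀ n, firstLevel p.2 ≤ n → n ≤ lastLevel p.2 → y n = y' n) :
    partialSum U q y = partialSum U q y' :=
  Finset.sum_congr rfl fun p hp => term_congr p q (h p hp)

/-- The indicator of the presence of `a n m` of the `i`-th family in `U`. -/
noncomputable def hasA (U : Finset (FamilyIndex s)) (i : Fin (s + 1)) (n : ℕ)
    (m : Fin (n + 1)) : ℝ :=
  if ((i, .inl ⟨n, m⟩) : FamilyIndex s) ∈ U then 1 else 0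

/-- The indicator of the presence of `b n m k` of the `i`-th family in `U`. -/
noncomputable def hasB (U : Finset (FamilyIndex s)) (i : Fin (s + 1)) (n : ℕ)
    (m : Fin (n + 1)) (k : Fin (n + 2)) : ℝ :=
  if ((i, .inr ⟨n, (m, k)⟩) : FamilyIndex s) ∈ U then 1 else 0

lemma hasB_eq (U : Finset (FamilyIndex s)) (i : Fin (s + 1)) (n : ℕ) (m : Fin (n + 1))
    (k : Fin (n + 2)) : hasB U i n m k = 0 ∨ hasB U i n m k = 1 := by
  unfold hasB; split_ifs <;> simp

lemma sum_filter_eq_of_injective {ι κ : Type*} [DecidableEq ι] [Fintype κ] (U : Finset ι)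
    (C : ι → Prop) [DecidablePred C] (e : κ → ι) (he : Function.Injective e)
    (hC : ∀ p, C p ↔ ∃ x, e x = p) (f : ι → ℝ) :
    ∑ p ∈ U with C p, f p = ∑ x, if e x ∈ U then f (e x) else 0 := by
  rw [← Finset.sum_filter]
  symm
  refine Finset.sum_bij (fun x _ => e x) ?_ ?_ ?_ ?_
  · intro x hx
    simp only [Finset.mem_filter, Finset.mem_univ, true_and] at hx ⊢
    exact ⟨hx, (hC _).2 ⟨x, rfl⟩⟩
  · intro x _ x' _ h
    exact he h
  · intro p hp
    simp only [Finset.mem_filter] at hp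
    obtain ⟨x, rfl⟩ := (hC p).1 hp.2
    exact ⟨x, by simpa using hp.1, rfl⟩
  · intro x _
    rfl

/-- The part of a partial sum which depends on the digits up to `j` only. -/
noncomputable def leftSum (U : Finset (FamilyIndex s)) (q : Fin (s + 2)) (j : ℕ) (y : Digits) : ℝ :=
  partialSum (U.filter fun p => lastLevel p.2 ≤ j) q y

lemma leftSum_congr (U : Finset (FamilyIndex s)) (q : Fin (s + 2)) (j : ℕ) {y y' : Digits}
    (h : ∀ n ≤ j, y n = y' n) : leftSum U q j y = leftSum U q j y' :=
  partialSum_congr _ _ fun _ hp n _ h2 => h n (h2.trans (Finset.mem_filter.1 hp).2)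

/-- The part of a partial sum which depends on the digits beyond `j` only. -/
noncomputable def rightSum (U : Finset (FamilyIndex s)) (q : Fin (s + 2)) (j : ℕ)
    (y : Digits) : ℝ :=
  partialSum (U.filter fun p => j < firstLevel p.2) q y

lemma rightSum_congr (U : Finset (FamilyIndex s)) (q : Fin (s + 2)) (j : ℕ) {y y' : Digits}
    (h : ∀ n, j < n → y n = y' n) : rightSum U q j y = rightSum U q j y' :=
  partialSum_congr _ _ fun _ hp n h1 _ => h n ((Finset.mem_filter.1 hp).2.trans_le h1)

/-- Cutting a partial sum of a Kadets family at the level `j`. -/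
theorem partialSum_eq_cut (U : Finset (FamilyIndex s)) (i : Fin (s + 1)) (j : ℕ) (y : Digits) :
    partialSum U i.succ y =
      leftSum U i.succ j y - hasB U i j (y j) (y (j + 1)) + rightSum U i.succ j y := by
  classical
  have h1 : ∑ p ∈ U with p.1 = i ∧ firstLevel p.2 ≤ j ∧ ¬ lastLevel p.2 ≤ j, term p i.succ y =
      -hasB U i j (y j) (y (j + 1)) := by
    rw [sum_filter_eq_of_injective U _
      (fun x : Fin (j + 1) × Fin (j + 2) => ((i, .inr ⟨j, x⟩) : FamilyIndex s))]
    · rw [Fintype.sum_prod_type]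
      -- Only the functions `b j m k` of family `i` straddle the cut, and among them only the one
      -- with `m = y j`, `k = y (j + 1)` is nonzero at `y`.
      rw [Finset.sum_eq_single (y j), Finset.sum_eq_single (y (j + 1))]
      · simp [kadetsTerm, digitIndicator, hasB, apply_ite]
      · intro k _ hk
        simp [kadetsTerm, digitIndicator, hk.symm]
      · simp
      · intro m _ hm
        simp [kadetsTerm, digitIndicator, hm.symm]
      · simp
    · intro x x' h
      simpa using h
    · rintro ⟨i', ⟨n, m⟩ | ⟨n, x⟩⟩
      · simp [firstLevel, lastLevel]
      · constructor
        · rintro ⟨h1, h2, h3⟩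
          simp only [firstLevel, lastLevel] at h1 h2 h3
          obtain rfl : n = j := by omega
          exact ⟨x, by rw [h1]⟩
        · rintro ⟨x', h⟩
          simp only [Prod.mk.injEq, Sum.inr.injEq, Sigma.mk.injEq] at h
          obtain ⟨rfl, rfl, _⟩ := h
          simp [firstLevel, lastLevel]
  have h2 : ∑ p ∈ U with ¬ lastLevel p.2 ≤ j, term p i.succ y =
      -hasB U i j (y j) (y (j + 1)) + rightSum U i.succ j y := by
    rw [← h1, rightSum, partialSum,
      ← Finset.sum_filter_add_sum_filter_not (U.filter fun p => ¬ lastLevel p.2 ≤ j)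
      (fun p => firstLevel p.2 ≤ j), Finset.filter_filter, Finset.filter_filter]
    congr 1
    · rw [Finset.sum_filter, Finset.sum_filter]
      refine Finset.sum_congr rfl fun p _ => ?_
      by_cases hp : i = p.1
      · simp [hp, and_comm]
      · simp [hp]
    · refine Finset.sum_congr (Finset.filter_congr fun p _ => ?_) fun _ _ => rfl
      have := firstLevel_le_lastLevel p.2
      constructor
      · rintro ⟨_, h⟩; omega
      · intro h; omega
  rw [partialSum, ← Finset.sum_filter_add_sum_filter_not U (fun p => lastLevel p.2 ≤ j), h2, leftSum,
    partialSum]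
  ring

/-- The part of the partial sum on the coupling cube which depends on the digit `j + 1`. -/
theorem partialSum_zero_eq (U : Finset (FamilyIndex s)) (j : ℕ) :
    ∃ R : Digits → ℝ, (∀ y k, R (Function.update y (j + 1) k) = R y) ∧ ∀ y, partialSum U 0 y =
      (∑ i, 𝔼 m, hasB U i j m (y (j + 1))) - hasA U (Fin.last s) (j + 1) (y (j + 1)) + R y := by
  classical
  -- On the coupling cube digit `j + 1` is seen only by the `b j m k` of all families (`C`) and by
  -- the `a (j + 1) k` of the last family (`C'`). The weight `1/(j+1)` of the former turns the sum
  -- over `m` into a mean.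
  let C : FamilyIndex s → Prop := fun p => ∃ x : Fin (s + 1) × Fin (j + 1) × Fin (j + 2),
    ((x.1, .inr ⟨j, x.2⟩) : FamilyIndex s) = p
  let C' : FamilyIndex s → Prop := fun p => ∃ x : Fin (j + 2),
    ((Fin.last s, .inl ⟨j + 1, x⟩) : FamilyIndex s) = p
  refine ⟨fun y => ∑ p ∈ U with ¬ C p ∧ ¬ C' p, term p 0 y, fun y k => ?_, fun y => ?_⟩
  · refine Finset.sum_congr rfl fun p hp => ?_
    obtain ⟨_, h1, h2⟩ := Finset.mem_filter.1 hp
    obtain ⟨i, ⟨n, m⟩ | ⟨n, m, k'⟩⟩ := p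
    · by_cases hi : i = Fin.last s
      · have : n ≠ j + 1 := by
          rintro rfl
          exact h2 ⟨m, by rw [hi]⟩
        simp [couplingTerm, digitIndicator, Function.update_of_ne this]
      · simp [couplingTerm, hi]
    · have : n + 1 ≠ j + 1 := by
        intro h
        obtain rfl : n = j := by omega
        exact h1 ⟨(i, m, k'), rfl⟩
      simp [couplingTerm, digitIndicator, Function.update_of_ne this]
  · have h1 : ∑ p ∈ U with C p, term p 0 y = ∑ i, 𝔼 m, hasB U i j m (y (j + 1)) := by
      rw [sum_filter_eq_of_injective U _
        (fun x : Fin (s + 1) × Fin (j + 1) × Fin (j + 2) => ((x.1, .inr ⟨j, x.2⟩) : FamilyIndex s))]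
      · rw [Fintype.sum_prod_type]
        refine Finset.sum_congr rfl fun i _ => ?_
        rw [Fintype.expect_eq_sum_div_card, Finset.sum_div, Fintype.sum_prod_type]
        refine Finset.sum_congr rfl fun m _ => ?_
        rw [Finset.sum_eq_single (y (j + 1))]
        · by_cases h : ((i, .inr ⟨j, (m, y (j + 1))⟩) : FamilyIndex s) ∈ U <;>
            simp [couplingTerm, digitIndicator, hasB, h]
        · intro k _ hk
          simp [couplingTerm, digitIndicator, hk.symm]
        · simp
      · rintro ⟨i, x⟩ ⟨i', x'⟩ h
        simpa using h
      · intro p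
        rfl
    have h2 : ∑ p ∈ U with C' p, term p 0 y = -hasA U (Fin.last s) (j + 1) (y (j + 1)) := by
      rw [sum_filter_eq_of_injective U _
        (fun x : Fin (j + 2) => ((Fin.last s, .inl ⟨j + 1, x⟩) : FamilyIndex s))]
      · rw [Finset.sum_eq_single (y (j + 1))]
        · by_cases h : ((Fin.last s, .inl ⟨j + 1, y (j + 1)⟩) : FamilyIndex s) ∈ U <;>
            simp [couplingTerm, digitIndicator, hasA, h]
        · intro k _ hk
          simp [couplingTerm, digitIndicator, hk.symm]
        · simp
      · intro x x' h
        simpa using h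
      · intro p
        rfl
    have h3 : ∑ p ∈ U with ¬ C p, term p 0 y =
        ∑ p ∈ U with C' p, term p 0 y + ∑ p ∈ U with ¬ C p ∧ ¬ C' p, term p 0 y := by
      rw [← Finset.sum_filter_add_sum_filter_not (U.filter fun p => ¬ C p) C', Finset.filter_filter,
        Finset.filter_filter]
      congr 1
      refine Finset.sum_congr (Finset.filter_congr fun p _ => ?_) fun _ _ => rfl
      constructor
      · rintro ⟨_, h⟩; exact h
      · rintro ⟨x, rfl⟩
        exact ⟨by rintro ⟨x', h⟩; simp at h, x, rfl⟩
    rw [partialSum, ← Finset.sum_filter_add_sum_filter_not U C, h3, h1, h2]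
    ring

end Terms

/-! ### Consequences of a partial sum being close to a constant. -/

section Estimates

variable {s J : ℕ} (U : Finset (FamilyIndex s)) (i : Fin (s + 1)) {j : ℕ} {c ε : ℝ}

/-- The mixed difference over four choices of the digits `j`, `j + 1` cancels the left and right
parts and leaves that of `hasB`; each of the four values of the partial sum is within `ε` of `c` on
average. -/
lemma additivityDefect_hasB_le (hj : j + 1 < J)
    (h : 𝔼 y : Word J, |partialSum U i.succ y.extend - c| ≤ ε) :
    additivityDefect (hasB U i j) ≤ 4 * ε := by
  let T : Word J → Fin (j + 1) → Fin (j + 2) → ℝ := fun y m k =>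
    |partialSum U i.succ (Function.update (Function.update y.extend j m) (j + 1) k) - c|
  have hT : 𝔼 y, 𝔼 m, 𝔼 k, T y m k ≤ ε :=
    (Word.expect_update₂ (fun y => |partialSum U i.succ y - c|) hj).trans_le h
  have key : ∀ (y : Word J) m m' k k', |hasB U i j m k - hasB U i j m' k - hasB U i j m k' +
      hasB U i j m' k'| ≤ T y m k + T y m' k + T y m k' + T y m' k' := by
    intro y m m' k k'
    let z : Fin (j + 1) → Fin (j + 2) → Digits := fun m k =>
      Function.update (Function.update y.extend j m) (j + 1) k
    have hz : ∀ m k, partialSum U i.succ (z m k) =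
        leftSum U i.succ j (z m 0) - hasB U i j m k + rightSum U i.succ j (z 0 k) := by
      intro m k
      rw [partialSum_eq_cut U i j]
      refine congrArg₂ (· + ·) (congrArg₂ (· - ·) ?_ ?_) ?_
      · refine leftSum_congr _ _ _ fun n hn => ?_
        have : n ≠ j + 1 := by omega
        simp [z, Function.update_of_ne this]
      · simp [z]
      · refine rightSum_congr _ _ _ fun n hn => ?_
        by_cases h1 : n = j + 1
        · subst h1; simp [z]
        · have : n ≠ j := by omega
          simp [z, Function.update_of_ne h1, Function.update_of_ne this]
    have e : hasB U i j m k - hasB U i j m' k - hasB U i j m k' + hasB U i j m' k' =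
        -(partialSum U i.succ (z m k) - c) + (partialSum U i.succ (z m' k) - c)
          + (partialSum U i.succ (z m k') - c) - (partialSum U i.succ (z m' k') - c) := by
      simp only [hz]; ring
    rw [e]
    calc _ ≤ |-(partialSum U i.succ (z m k) - c)| + |partialSum U i.succ (z m' k) - c|
          + |partialSum U i.succ (z m k') - c| + |partialSum U i.succ (z m' k') - c| := by
          refine (abs_sub _ _).trans (add_le_add_left ((abs_add_le _ _).trans ?_) _)
          exact add_le_add_left (abs_add_le _ _) _
      _ = _ := by rw [abs_neg]
  calc additivityDefect (hasB U i j) = 𝔼 _y : Word J, additivityDefect (hasB U i j) := by simp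
    _ ≤ 𝔼 y, 𝔼 m, 𝔼 m', 𝔼 k, 𝔼 k', (T y m k + T y m' k + T y m k' + T y m' k') := by
        unfold additivityDefect
        iterate 5 refine Finset.expect_le_expect fun _ _ => ?_
        exact key _ _ _ _ _
    _ = 4 * 𝔼 y, 𝔼 m, 𝔼 k, T y m k := by
        simp only [Finset.expect_add_distrib, Fintype.expect_const]
        ring
    _ ≤ 4 * ε := by linarith

lemma partialSum_splice (x x' : Digits) : partialSum U i.succ (Digits.splice j x x') =
    leftSum U i.succ j x - hasB U i j (x j) (x' (j + 1)) + rightSum U i.succ j x' := by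
  rw [partialSum_eq_cut U i j]
  refine congrArg₂ (· + ·) (congrArg₂ (· - ·) ?_ ?_) ?_
  · exact leftSum_congr _ _ _ fun n hn => by simp [Digits.splice, hn]
  · simp [Digits.splice]
  · exact rightSum_congr _ _ _ fun n hn => by simp [Digits.splice, hn.not_ge]

/-- Both the spliced word and `x'` are uniformly distributed, so each deviation from `c` costs `ε`.
-/
lemma expect_splice_le (h : 𝔼 y : Word J, |partialSum U i.succ y.extend - c| ≤ ε)
    (g f : Word J → Word J → ℝ)
    (hg : ∀ x x' : Word J, |g x x'| ≤ |partialSum U i.succ (Digits.splice j x.extend x'.extend) - c|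
      + |partialSum U i.succ x'.extend - c| + f x x') :
    𝔼 x, 𝔼 x', |g x x'| ≤ 2 * ε + 𝔼 x, 𝔼 x', f x x' := by
  have h1 := Word.expect_splice (J := J) (fun y => |partialSum U i.succ y - c|) j
  calc _ ≤ 𝔼 x, 𝔼 x', (|partialSum U i.succ (Digits.splice j x.extend x'.extend) - c|
      + |partialSum U i.succ x'.extend - c| + f x x') :=
        Finset.expect_le_expect fun _ _ => Finset.expect_le_expect fun _ _ => hg _ _
    _ ≤ _ := by
      simp only [Finset.expect_add_distrib, Fintype.expect_const]
      linarith

/-- Replacing the head of `x'` by that of `x` keeps the right part, so the left part changes only by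
the change of the partial sum plus that of `hasB` within the fixed column `x' (j + 1)`. -/
lemma leftSum_oscillation_le (hj : j + 1 < J)
    (h : 𝔼 y : Word J, |partialSum U i.succ y.extend - c| ≤ ε) :
    𝔼 x : Word J, 𝔼 x' : Word J, |leftSum U i.succ j x.extend - leftSum U i.succ j x'.extend| ≤
      2 * ε + rowOscillation (hasB U i j) := by
  have e : rowOscillation (hasB U i j) = 𝔼 x : Word J, 𝔼 x' : Word J,
      |hasB U i j (x.extend j) (x'.extend (j + 1)) -
        hasB U i j (x'.extend j) (x'.extend (j + 1))| := by
    rw [rowOscillation, ← Word.expect_digit (J := J) (by omega)]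
    refine Finset.expect_congr rfl fun x _ => ?_
    exact (Word.expect_digit₂ hj fun m' k => |hasB U i j (x.extend j) k - hasB U i j m' k|).symm
  rw [e]
  refine expect_splice_le (j := j) U i h _ _ fun x x' => ?_
  have h1 := partialSum_splice (j := j) U i x.extend x'.extend
  have h2 := partialSum_eq_cut U i j x'.extend
  rw [show leftSum U i.succ j x.extend - leftSum U i.succ j x'.extend =
    (partialSum U i.succ (Digits.splice j x.extend x'.extend) - c) -
    (partialSum U i.succ x'.extend - c) + (hasB U i j (x.extend j) (x'.extend (j + 1)) -
        hasB U i j (x'.extend j) (x'.extend (j + 1))) by rw [h1, h2]; ring]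
  exact (abs_add_le _ _).trans (add_le_add_left (abs_sub _ _) _)

/-- As for `leftSum_oscillation_le`, but `hasB` is now attached to the head: in the spliced word its
column changes within the fixed row `x j`, which produces the oscillation of the transposed matrix.
-/
lemma leftSum_sub_hasB_oscillation_le (hj : j + 1 < J)
    (h : 𝔼 y : Word J, |partialSum U i.succ y.extend - c| ≤ ε) :
    𝔼 x : Word J, 𝔼 x' : Word J,
      |(leftSum U i.succ j x.extend - hasB U i j (x.extend j) (x.extend (j + 1))) -
        (leftSum U i.succ j x'.extend - hasB U i j (x'.extend j) (x'.extend (j + 1)))| ≤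
      2 * ε + rowOscillation (fun k m => hasB U i j m k) := by
  have e : rowOscillation (fun k m => hasB U i j m k) = 𝔼 x : Word J, 𝔼 x' : Word J,
      |hasB U i j (x.extend j) (x'.extend (j + 1)) -
        hasB U i j (x.extend j) (x.extend (j + 1))| := by
    have : ∀ x : Word J, 𝔼 x' : Word J, |hasB U i j (x.extend j) (x'.extend (j + 1)) -
        hasB U i j (x.extend j) (x.extend (j + 1))| = 𝔼 k, |hasB U i j (x.extend j) k -
        hasB U i j (x.extend j) (x.extend (j + 1))| := fun x => Word.expect_digit hj
          fun k => |hasB U i j (x.extend j) k - hasB U i j (x.extend j) (x.extend (j + 1))|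
    simp only [this]
    rw [Word.expect_digit₂ hj fun m k' => 𝔼 k, |hasB U i j m k - hasB U i j m k'|, rowOscillation]
    symm
    rw [Finset.expect_comm Finset.univ Finset.univ]
    refine Finset.expect_congr rfl fun k _ => ?_
    rw [Finset.expect_comm]
    simp only [abs_sub_comm]
  rw [e]
  refine expect_splice_le (j := j) U i h _ _ fun x x' => ?_
  have h1 := partialSum_splice (j := j) U i x.extend x'.extend
  have h2 := partialSum_eq_cut U i j x'.extend
  rw [show leftSum U i.succ j x.extend - hasB U i j (x.extend j) (x.extend (j + 1)) -
        (leftSum U i.succ j x'.extend - hasB U i j (x'.extend j) (x'.extend (j + 1))) =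
    (partialSum U i.succ (Digits.splice j x.extend x'.extend) - c) -
    (partialSum U i.succ x'.extend - c) + (hasB U i j (x.extend j) (x'.extend (j + 1)) -
        hasB U i j (x.extend j) (x.extend (j + 1))) by rw [h1, h2]; ring]
  exact (abs_add_le _ _).trans (add_le_add_left (abs_sub _ _) _)

/-- Resampling digit `j + 1` alone leaves the remainder `R` fixed, while both partial sums stay
close to `c`. -/
lemma coupling_oscillation_le (hj : j + 1 < J)
    (h : 𝔼 y : Word J, |partialSum U 0 y.extend - c| ≤ ε) :
    𝔼 k, 𝔼 k', |((∑ i, 𝔼 m, hasB U i j m k) - hasA U (Fin.last s) (j + 1) k) -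
      ((∑ i, 𝔼 m, hasB U i j m k') - hasA U (Fin.last s) (j + 1) k')| ≤ 2 * ε := by
  obtain ⟨R, hR, hS⟩ := partialSum_zero_eq U j
  let T : Word J → Fin (j + 2) → ℝ := fun y k =>
    |partialSum U 0 (Function.update y.extend (j + 1) k) - c|
  have hT : 𝔼 y, 𝔼 k, T y k ≤ ε :=
    (Word.expect_update (fun y => |partialSum U 0 y - c|) hj).trans_le h
  have key : ∀ (y : Word J) k k',
      |((∑ i, 𝔼 m, hasB U i j m k) - hasA U (Fin.last s) (j + 1) k) -
      ((∑ i, 𝔼 m, hasB U i j m k') - hasA U (Fin.last s) (j + 1) k')| ≤ T y k + T y k' := by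
    intro y k k'
    have h1 := hS (Function.update y.extend (j + 1) k)
    have h2 := hS (Function.update y.extend (j + 1) k')
    rw [hR, Function.update_self] at h1 h2
    have e : ((∑ i, 𝔼 m, hasB U i j m k) - hasA U (Fin.last s) (j + 1) k) -
      ((∑ i, 𝔼 m, hasB U i j m k') - hasA U (Fin.last s) (j + 1) k') =
      (partialSum U 0 (Function.update y.extend (j + 1) k) - c) -
      (partialSum U 0 (Function.update y.extend (j + 1) k') - c) := by rw [h1, h2]; ring
    rw [e]
    exact abs_sub _ _
  calc _ = 𝔼 _y : Word J, _ := (Fintype.expect_const _).symm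
    _ ≤ 𝔼 y, 𝔼 k, 𝔼 k', (T y k + T y k') := by
        iterate 3 refine Finset.expect_le_expect fun _ _ => ?_
        exact key _ _ _
    _ = 2 * 𝔼 y, 𝔼 k, T y k := by
        simp only [Finset.expect_add_distrib, Fintype.expect_const]
        ring
    _ ≤ 2 * ε := by linarith

lemma expect_digitIndicator {n : ℕ} (hn : n < J) (m : Fin (n + 1)) :
    𝔼 y : Word J, digitIndicator n m y.extend = 1 / ((n : ℝ) + 1) := by
  have := Word.expect_digit hn fun m' => if m' = m then (1 : ℝ) else 0
  simp only [digitIndicator]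
  rw [this, Fintype.expect_eq_sum_div_card]
  simp

lemma expect_digitIndicator_mul {n : ℕ} (hn : n + 1 < J) (m : Fin (n + 1)) (k : Fin (n + 2)) :
    𝔼 y : Word J, digitIndicator n m y.extend * digitIndicator (n + 1) k y.extend =
      1 / ((n : ℝ) + 1) * (1 / ((n : ℝ) + 2)) := by
  have := Word.expect_digit₂ hn fun m' k' => (if m' = m then (1 : ℝ) else 0) *
    (if k' = k then (1 : ℝ) else 0)
  simp only [digitIndicator]
  rw [this, ← Fintype.expect_mul_expect]
  congr 1
  · rw [Fintype.expect_eq_sum_div_card]; simp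
  · rw [Fintype.expect_eq_sum_div_card]
    simp only [Finset.sum_ite_eq', Finset.mem_univ, if_true, Fintype.card_fin]
    push_cast; ring

/-- The mean value on the coupling cube compensates the mean values on the other cubes. -/
lemma expect_partialSum_zero (hU : ∀ p ∈ U, lastLevel p.2 < J) :
    𝔼 y : Word J, partialSum U 0 y.extend = -∑ i : Fin (s + 1),
      𝔼 y : Word J, partialSum U i.succ y.extend := by
  -- The identity holds term by term: the mean of each function on the coupling cube is the negative
  -- of its mean on the cube of its family.
  simp only [partialSum, Finset.expect_sum_comm]
  rw [Finset.sum_comm, ← Finset.sum_neg_distrib]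
  refine Finset.sum_congr rfl fun p hp => ?_
  have hp := hU p hp
  simp only [term_succ, term_zero]
  rw [Finset.sum_eq_single p.1 (fun i _ hi => by simp [hi]) (by simp)]
  obtain ⟨i, ⟨n, m⟩ | ⟨n, m, k⟩⟩ := p
  · simp only [couplingTerm, kadetsTerm, if_true]
    simp only [lastLevel] at hp
    rw [expect_digitIndicator hp]
    split_ifs
    · rw [Finset.expect_neg_distrib, expect_digitIndicator hp]
    · simp
  · simp only [couplingTerm, kadetsTerm, if_true]
    simp only [lastLevel] at hp
    rw [← Finset.expect_div, expect_digitIndicator hp, Finset.expect_neg_distrib,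
      expect_digitIndicator_mul hp]
    push_cast
    field_simp
    ring

/-- All values of the partial sums on the cubes carrying Kadets families are integers. -/
lemma exists_partialSum_eq_int (y : Digits) : ∃ z : ℤ, partialSum U i.succ y = z := by
  have h : ∀ p : FamilyIndex s, ∃ z : ℤ, term p i.succ y = z := by
    rintro ⟨i', ⟨n, m⟩ | ⟨n, m, k⟩⟩
    · refine ⟨if i = i' then if y n = m then 1 else 0 else 0, ?_⟩
      simp only [term_succ, kadetsTerm, digitIndicator]
      split_ifs <;> simp
    · refine ⟨if i = i' then if y n = m then if y (n + 1) = k then -1 else 0 else 0 else 0, ?_⟩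
      simp only [term_succ, kadetsTerm, digitIndicator]
      split_ifs <;> simp
  choose z hz using h
  exact ⟨∑ p ∈ U, z p, by simp [partialSum, hz]⟩

end Estimates

/-! ### Enumerations, telescoping sums and first constraints on limits. -/

section LimitsOnDigits

variable {s : ℕ}

/-- For `i ∈ T` the entry `v i m k` is close to its mean over `m`; for `i ∉ T` that mean hardly
depends on `k`. So the means in `hW` may be replaced by the entries for `i ∈ T` and dropped
otherwise, which makes the expression integer-valued for `0`-`1` data. Each index costs at most
`2δ`. -/
lemma expect_coupled_oscillation_le {ι α β : Type*} [Fintype ι] [DecidableEq ι] [Fintype α]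
    [Fintype β] [Nonempty α] [Nonempty β] (v : ι → α → β → ℝ) (u : β → ℝ) (T : Finset ι) {δ η : ℝ}
    (hW : 𝔼 k, 𝔼 k', |((∑ i, 𝔼 m, v i m k) - u k) - ((∑ i, 𝔼 m, v i m k') - u k')| ≤ η)
    (hδ : 0 ≤ δ)
    (hT : ∀ i ∈ T, rowOscillation (v i) ≤ δ)
    (hT' : ∀ i ∉ T, rowOscillation (fun k m => v i m k) ≤ δ) :
    𝔼 m, 𝔼 k, 𝔼 m', 𝔼 k', |((∑ i ∈ T, v i m k) - u k) - ((∑ i ∈ T, v i m' k') - u k')| ≤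
      η + 2 * Fintype.card ι * δ := by
  have key : ∀ m k m' k', |((∑ i ∈ T, v i m k) - u k) - ((∑ i ∈ T, v i m' k') - u k')| ≤
      |((∑ i, 𝔼 m, v i m k) - u k) - ((∑ i, 𝔼 m, v i m k') - u k')| +
      ∑ i ∈ T, (|v i m k - 𝔼 m, v i m k| + |v i m' k' - 𝔼 m, v i m k'|) +
      ∑ i ∈ Tᶜ, |(𝔼 m, v i m k) - 𝔼 m, v i m k'| := by
    intro m k m' k'
    have e : ((∑ i ∈ T, v i m k) - u k) - ((∑ i ∈ T, v i m' k') - u k') =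
        (((∑ i, 𝔼 m, v i m k) - u k) - ((∑ i, 𝔼 m, v i m k') - u k')) +
        ∑ i ∈ T, ((v i m k - 𝔼 m, v i m k) - (v i m' k' - 𝔼 m, v i m k')) -
        ∑ i ∈ Tᶜ, ((𝔼 m, v i m k) - 𝔼 m, v i m k') := by
      rw [← Finset.sum_add_sum_compl T, ← Finset.sum_add_sum_compl T]
      simp only [Finset.sum_sub_distrib]
      ring
    rw [e]
    refine (abs_sub _ _).trans (add_le_add ((abs_add_le _ _).trans (add_le_add le_rfl ?_))
      (Finset.abs_sum_le_sum_abs _ _))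
    exact (Finset.abs_sum_le_sum_abs _ _).trans (Finset.sum_le_sum fun i _ => abs_sub _ _)
  have h1 : ∀ i, 𝔼 m, 𝔼 k, |v i m k - 𝔼 m, v i m k| ≤ rowOscillation (v i) := by
    intro i
    rw [rowOscillation]
    refine Finset.expect_le_expect fun m _ => ?_
    rw [Finset.expect_comm]
    refine Finset.expect_le_expect fun k _ => ?_
    refine le_trans (le_of_eq ?_) (Finset.abs_expect_le _ _)
    rw [Finset.expect_sub_distrib, Fintype.expect_const]
  have h2 : ∀ i, 𝔼 k, 𝔼 k', |(𝔼 m, v i m k) - 𝔼 m, v i m k'| ≤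
      rowOscillation (fun k m => v i m k) := by
    intro i
    rw [rowOscillation]
    refine Finset.expect_le_expect fun k _ => Finset.expect_le_expect fun k' _ => ?_
    refine le_trans (le_of_eq ?_) (Finset.abs_expect_le _ _)
    rw [Finset.expect_sub_distrib]
  calc _ ≤ 𝔼 m, 𝔼 k, 𝔼 m', 𝔼 k',
        (|((∑ i, 𝔼 m, v i m k) - u k) - ((∑ i, 𝔼 m, v i m k') - u k')| +
      ∑ i ∈ T, (|v i m k - 𝔼 m, v i m k| + |v i m' k' - 𝔼 m, v i m k'|) +
      ∑ i ∈ Tᶜ, |(𝔼 m, v i m k) - 𝔼 m, v i m k'|) := by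
        iterate 4 refine Finset.expect_le_expect fun _ _ => ?_
        exact key _ _ _ _
    _ = 𝔼 k, 𝔼 k', |((∑ i, 𝔼 m, v i m k) - u k) - ((∑ i, 𝔼 m, v i m k') - u k')| +
        ∑ i ∈ T, 2 * 𝔼 m, 𝔼 k, |v i m k - 𝔼 m, v i m k| +
        ∑ i ∈ Tᶜ, 𝔼 k, 𝔼 k', |(𝔼 m, v i m k) - 𝔼 m, v i m k'| := by
        simp only [Finset.expect_add_distrib, Finset.expect_sum_comm, Fintype.expect_const,
          Finset.sum_add_distrib, two_mul]
    _ ≤ η + ∑ i ∈ T, 2 * δ + ∑ i ∈ Tᶜ, 2 * δ := by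
        refine add_le_add (add_le_add hW (Finset.sum_le_sum fun i hi => ?_))
          (Finset.sum_le_sum fun i hi => ?_)
        · linarith [h1 i, hT i hi]
        · linarith [h2 i, hT' i (Finset.mem_compl.1 hi)]
    _ = _ := by
        rw [add_assoc, Finset.sum_add_sum_compl]
        simp
        ring

/-- The first `K` indices of an enumeration. -/
def initialIndices {ι : Type*} (e : ℕ ≃ ι) (K : ℕ) : Finset ι :=
  (Finset.range K).map e.toEmbedding

lemma mem_initialIndices {ι : Type*} {e : ℕ ≃ ι} {K : ℕ} {p : ι} :
    p ∈ initialIndices e K ↔ e.symm p < K := by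
  simp only [initialIndices, Finset.mem_map_equiv, Finset.mem_range]

lemma initialIndices_mono {ι : Type*} (e : ℕ ≃ ι) : Monotone (initialIndices e) :=
  fun _ _ h _ hp => mem_initialIndices.2 ((mem_initialIndices.1 hp).trans_le h)

lemma initialIndices_succ {ι : Type*} [DecidableEq ι] (e : ℕ ≃ ι) (K : ℕ) :
    initialIndices e (K + 1) = insert (e K) (initialIndices e K) := by
  ext p
  simp only [Finset.mem_insert, mem_initialIndices, Nat.lt_succ_iff_lt_or_eq, ← e.symm_apply_eq]
  tauto

lemma exists_subset_initialIndices {ι : Type*} (e : ℕ ≃ ι) (F : Finset ι) :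
    ∃ K, F ⊆ initialIndices e K := by
  refine ⟨F.sup e.symm + 1, fun p hp => mem_initialIndices.2 (Nat.lt_succ_of_le ?_)⟩
  exact Finset.le_sup (f := e.symm) hp

lemma sum_initialIndices {ι E : Type*} [AddCommMonoid E] (e : ℕ ≃ ι) (K : ℕ) (f : ι → E) :
    ∑ p ∈ initialIndices e K, f p = ∑ k ∈ Finset.range K, f (e k) := by
  simp [initialIndices]

/-- The indices of the functions which depend on the digits up to `j` only. -/
def fullIndices (s j : ℕ) : Finset (FamilyIndex s) :=
  Finset.univ ×ˢ ((Finset.range (j + 1)).sigma fun _ => Finset.univ).disjSum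
    ((Finset.range j).sigma fun _ => Finset.univ)

lemma mem_fullIndices {j : ℕ} {p : FamilyIndex s} :
    p ∈ fullIndices s j ↔ lastLevel p.2 ≤ j := by
  obtain ⟨i, ⟨n, m⟩ | ⟨n, m⟩⟩ := p
  · simp [fullIndices, lastLevel]
  · simp [fullIndices, lastLevel]

lemma sum_digitIndicator (n : ℕ) (y : Digits) : ∑ m, digitIndicator n m y = 1 := by
  simp [digitIndicator]

/-- The sum of all functions which depend on the digits up to `j` only is constant. -/
lemma leftSum_of_fullIndices_subset {U : Finset (FamilyIndex s)} {j : ℕ} (hU : fullIndices s j ⊆ U)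
    (q : Fin (s + 2)) (y : Digits) :
    leftSum U q j y = Fin.cases (-((s : ℝ) + 1)) (fun _ => 1) q := by
  have h1 : U.filter (fun p => lastLevel p.2 ≤ j) = fullIndices s j := by
    ext p
    rw [Finset.mem_filter, mem_fullIndices]
    exact ⟨fun h => h.2, fun h => ⟨hU (mem_fullIndices.2 h), h⟩⟩
  rw [leftSum, h1, partialSum, fullIndices, Finset.sum_product]
  simp only [Finset.sum_disjSum, Finset.sum_sigma]
  refine Fin.cases ?_ (fun i => ?_) q
  -- Each family contributes `-1` for each of the `j + 1` levels of `a` and `1` for each of the `j`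
  -- levels of `b`; on the family cubes the signs are opposite.
  · have ha : ∀ (i : Fin (s + 1)) (n : ℕ), ∑ m, term (i, .inl ⟨n, m⟩) 0 y = -1 := by
      intro i n
      simp only [term_zero, couplingTerm]
      split_ifs
      · rw [Finset.sum_neg_distrib, sum_digitIndicator]
      · rw [Finset.sum_const, Finset.card_univ, Fintype.card_fin, nsmul_eq_mul]
        push_cast
        field_simp
    have hb : ∀ (i : Fin (s + 1)) (n : ℕ), ∑ x, term (i, .inr ⟨n, x⟩) 0 y = 1 := by
      intro i n
      rw [Fintype.sum_prod_type]
      simp only [term_zero, couplingTerm, ← Finset.sum_div, sum_digitIndicator]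
      rw [Finset.sum_const, Finset.card_univ, Fintype.card_fin, nsmul_eq_mul]
      push_cast
      field_simp
    simp only [ha, hb, Finset.sum_const, Finset.card_range, Finset.card_univ, Fintype.card_fin,
      nsmul_eq_mul, Fin.cases_zero]
    push_cast
    ring
  · have ha : ∀ (i' : Fin (s + 1)) (n : ℕ), ∑ m, term (i', .inl ⟨n, m⟩) i.succ y =
        if i = i' then 1 else 0 := by
      intro i' n
      simp only [term_succ, kadetsTerm]
      split_ifs
      · exact sum_digitIndicator n y
      · simp
    have hb : ∀ (i' : Fin (s + 1)) (n : ℕ), ∑ x, term (i', .inr ⟨n, x⟩) i.succ y =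
        -if i = i' then 1 else 0 := by
      intro i' n
      rw [Fintype.sum_prod_type]
      simp only [term_succ, kadetsTerm]
      split_ifs
      · simp only [Finset.sum_neg_distrib, ← Finset.mul_sum, sum_digitIndicator, mul_one]
      · simp
    simp only [ha, hb, Finset.sum_const, Finset.card_range, nsmul_eq_mul, Fin.cases_succ,
      Finset.sum_add_distrib, ← Finset.mul_sum, Finset.sum_neg_distrib, Finset.sum_ite_eq,
      Finset.mem_univ, if_true]
    push_cast
    ring

lemma partialSum_filter_firstLevel (U : Finset (FamilyIndex s)) (i : Fin (s + 1)) (j : ℕ)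
    (y : Digits) : partialSum (U.filter fun p => firstLevel p.2 ≤ j) i.succ y =
      leftSum U i.succ j y - hasB U i j (y j) (y (j + 1)) := by
  have h1 := partialSum_eq_cut U i j y
  have h2 := Finset.sum_filter_add_sum_filter_not U (fun p => firstLevel p.2 ≤ j)
    (fun p => term p i.succ y)
  simp only [not_le] at h2
  simp only [partialSum, rightSum] at h1 h2 ⊢
  linarith

lemma partialSum_insert_filter (U : Finset (FamilyIndex s))
    {p : FamilyIndex s} (hp : p ∉ U) (P : FamilyIndex s → Prop) [DecidablePred P] (q : Fin (s + 2))
    (y : Digits) : |partialSum ((insert p U).filter P) q y - partialSum (U.filter P) q y| ≤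
      |term p q y| := by
  rw [Finset.filter_insert]
  split_ifs with h
  · rw [partialSum, Finset.sum_insert (by simp [hp]), partialSum, add_sub_cancel_right]
  · simp

/-- The entry at `y` changes only if the new function is the `b` that equals `-1` at `y`. Thus small
`L¹` norms of the terms make `hasB` move in small steps. -/
lemma abs_hasB_insert_sub_le (U : Finset (FamilyIndex s))
    (p : FamilyIndex s) (i : Fin (s + 1)) (j : ℕ) (y : Digits) :
    |hasB (insert p U) i j (y j) (y (j + 1)) - hasB U i j (y j) (y (j + 1))| ≤
      |term p i.succ y| := by
  by_cases h : ((i, .inr ⟨j, (y j, y (j + 1))⟩) : FamilyIndex s) = p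
  · subst h
    have : |term ((i, .inr ⟨j, (y j, y (j + 1))⟩) : FamilyIndex s) i.succ y| = 1 := by
      simp [kadetsTerm, digitIndicator]
    rw [this]
    exact abs_sub_le_one (hasB_eq _ _ _ _ _) (hasB_eq _ _ _ _ _)
  · simp [hasB, h]

lemma abs_hasA_insert_sub_le (U : Finset (FamilyIndex s))
    (p : FamilyIndex s) (i : Fin (s + 1)) (j : ℕ) (y : Digits) :
    |hasA (insert p U) i j (y j) - hasA U i j (y j)| ≤ |term p i.succ y| := by
  by_cases h : ((i, .inl ⟨j, y j⟩) : FamilyIndex s) = p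
  · subst h
    have : |term ((i, .inl ⟨j, y j⟩) : FamilyIndex s) i.succ y| = 1 := by
      simp [kadetsTerm, digitIndicator]
    rw [this]
    unfold hasA
    split_ifs <;> norm_num
  · simp [hasA, h]

/-- The values of the `i₀`-th point of the sum range on the cubes. -/
def limitValue (i₀ : Fin (s + 1)) : Fin (s + 2) → ℝ :=
  Fin.cases (-1) (fun i => if i = i₀ then 1 else 0)

/-- Convergence of a rearrangement to a function with the value `c q` on the cube `q`. -/
def ConvergesOnDigits (e : ℕ ≃ FamilyIndex s) (c : Fin (s + 2) → ℝ) : Prop :=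
  ∀ ε > 0, ∃ K₀, ∀ K ≥ K₀, ∀ q J, (∀ p ∈ initialIndices e K, lastLevel p.2 < J) →
    𝔼 y : Word J, |partialSum (initialIndices e K) q y.extend - c q| ≤ ε

lemma exists_lastLevel_lt (U : Finset (FamilyIndex s)) : ∃ J, ∀ p ∈ U, lastLevel p.2 < J :=
  ⟨U.sup (fun p => lastLevel p.2) + 1, fun _ hp =>
    Nat.lt_succ_of_le (Finset.le_sup (f := fun p : FamilyIndex s => lastLevel p.2) hp)⟩

/-- Partial sums on the family cubes are integer-valued, so they cannot approach a number at
positive distance from the integers. -/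
lemma ConvergesOnDigits.exists_eq_int {e : ℕ ≃ FamilyIndex s} {c : Fin (s + 2) → ℝ}
    (h : ConvergesOnDigits e c) (i : Fin (s + 1)) : ∃ z : ℤ, c i.succ = z := by
  refine ⟨round (c i.succ), ?_⟩
  by_contra hne
  have hpos : 0 < |c i.succ - round (c i.succ)| := abs_pos.2 (sub_ne_zero.2 hne)
  obtain ⟨K, hK⟩ := h _ (half_pos hpos)
  obtain ⟨J, hJ⟩ := exists_lastLevel_lt (initialIndices e K)
  obtain ⟨y, -, hy⟩ := Finset.exists_le_of_expect_le Finset.univ_nonempty (hK K le_rfl i.succ J hJ)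
  obtain ⟨z, hz⟩ := exists_partialSum_eq_int (initialIndices e K) i y.extend
  rw [hz, abs_sub_comm] at hy
  have := round_le (c i.succ) z
  linarith

/-- The means of a partial sum over all cubes add up to zero, by `expect_partialSum_zero`. -/
lemma ConvergesOnDigits.zero_eq {e : ℕ ≃ FamilyIndex s} {c : Fin (s + 2) → ℝ}
    (h : ConvergesOnDigits e c) : c 0 = -∑ i : Fin (s + 1), c i.succ := by
  rw [eq_neg_iff_add_eq_zero, ← abs_eq_zero]
  refine le_antisymm (le_of_forall_pos_le_add fun ε hε => ?_) (abs_nonneg _)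
  obtain ⟨K, hK⟩ := h (ε / (s + 2)) (by positivity)
  obtain ⟨J, hJ⟩ := exists_lastLevel_lt (initialIndices e K)
  have h1 := expect_partialSum_zero (initialIndices e K) hJ
  have h2 : ∀ q, |(𝔼 y : Word J, partialSum (initialIndices e K) q y.extend) - c q| ≤
      ε / (s + 2) := by
    intro q
    refine le_trans (le_trans (le_of_eq ?_) (Finset.abs_expect_le _ _)) (hK K le_rfl q J hJ)
    rw [Finset.expect_sub_distrib, Fintype.expect_const]
  have e1 : c 0 + ∑ i : Fin (s + 1), c i.succ = -∑ q : Fin (s + 2),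
      ((𝔼 y : Word J, partialSum (initialIndices e K) q y.extend) - c q) := by
    rw [Fin.sum_univ_succ (n := s + 1) fun q => _ - c q, h1, Finset.sum_sub_distrib]
    ring
  rw [e1, abs_neg]
  refine (Finset.abs_sum_le_sum_abs _ _).trans ((Finset.sum_le_sum fun q _ => h2 q).trans ?_)
  rw [Finset.sum_const, Finset.card_univ, Fintype.card_fin, nsmul_eq_mul]
  push_cast
  field_simp
  linarith

end LimitsOnDigits

/-! ### Rigidity: exactly one family has sum 1. -/

section Rigidity

variable {s : ℕ}

/-- Over the times from `K₀` to `K₁` all functions which depend on the digits up to `j + 1` only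
appear in the series, while its partial sums stay close to the limit. -/
structure IsWindow (e : ℕ ≃ FamilyIndex s) (c : Fin (s + 2) → ℝ) (ε : ℝ) (J j K₀ K₁ : ℕ) :
    Prop where
  le : K₀ ≤ K₁
  lt : j + 1 < J
  close : ∀ K, K₀ ≤ K → K ≤ K₁ → ∀ q,
    𝔼 y : Word J, |partialSum (initialIndices e K) q y.extend - c q| ≤ ε
  start : ∀ p ∈ initialIndices e K₀, lastLevel p.2 < j
  full : fullIndices s (j + 1) ⊆ initialIndices e K₁

lemma ConvergesOnDigits.exists_isWindow {e : ℕ ≃ FamilyIndex s} {c : Fin (s + 2) → ℝ}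
    (h : ConvergesOnDigits e c) {ε : ℝ} (hε : 0 < ε) : ∃ J j K₀ K₁, IsWindow e c ε J j K₀ K₁ := by
  obtain ⟨K₀, hK₀⟩ := h ε hε
  obtain ⟨j, hj⟩ := exists_lastLevel_lt (initialIndices e K₀)
  obtain ⟨K, hK⟩ := exists_subset_initialIndices e (fullIndices s (j + 1))
  obtain ⟨J, hJ⟩ := exists_lastLevel_lt (initialIndices e (max K K₀))
  refine ⟨max J (j + 2), j, K₀, max K K₀, le_max_right _ _, by omega, fun K' h0 h1 q => ?_, hj,
    hK.trans (initialIndices_mono e (le_max_left _ _))⟩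
  exact hK₀ K' h0 q _ fun p hp =>
    (hJ p (initialIndices_mono e h1 hp)).trans_le (le_max_left _ _)

namespace IsWindow

variable {e : ℕ ≃ FamilyIndex s} {c : Fin (s + 2) → ℝ} {ε : ℝ} {J j K₀ K₁ : ℕ}

lemma expect_term_le (h : IsWindow e c ε J j K₀ K₁) {K : ℕ} (h0 : K₀ ≤ K) (h1 : K < K₁)
    (q : Fin (s + 2)) : 𝔼 y : Word J, |term (e K) q y.extend| ≤ 2 * ε := by
  have h2 := h.close K h0 h1.le q
  have h3 := h.close (K + 1) (by omega) h1 q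
  have h4 := expect_abs_sub_le (fun y : Word J => partialSum (initialIndices e (K + 1)) q y.extend)
    (fun _ => c q) (fun y => partialSum (initialIndices e K) q y.extend)
  have h5 : ∀ y : Word J, partialSum (initialIndices e (K + 1)) q y.extend -
      partialSum (initialIndices e K) q y.extend = term (e K) q y.extend := by
    intro y
    simp only [partialSum, sum_initialIndices, Finset.sum_range_succ]
    ring
  simp only [h5] at h4
  simp only [abs_sub_comm (c q)] at h4
  linarith

lemma initialIndices_succ_eq (e : ℕ ≃ FamilyIndex s) (K : ℕ) :
    initialIndices e (K + 1) = insert (e K) (initialIndices e K) ∧ e K ∉ initialIndices e K :=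
  ⟨initialIndices_succ e K, by simp [mem_initialIndices]⟩

lemma hasB_start (h : IsWindow e c ε J j K₀ K₁) (i : Fin (s + 1)) (m : Fin (j + 1))
    (k : Fin (j + 2)) : hasB (initialIndices e K₀) i j m k = 0 := by
  rw [hasB, if_neg]
  intro hp
  have := h.start _ hp
  simp [lastLevel] at this

lemma hasB_end (h : IsWindow e c ε J j K₀ K₁) (i : Fin (s + 1)) (m : Fin (j + 1))
    (k : Fin (j + 2)) : hasB (initialIndices e K₁) i j m k = 1 := by
  rw [hasB, if_pos]
  exact h.full (mem_fullIndices.2 (by simp [lastLevel]))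

lemma hasA_start (h : IsWindow e c ε J j K₀ K₁) (i : Fin (s + 1)) (m : Fin (j + 2)) :
    hasA (initialIndices e K₀) i (j + 1) m = 0 := by
  rw [hasA, if_neg]
  intro hp
  have := h.start _ hp
  simp [lastLevel] at this

lemma hasA_end (h : IsWindow e c ε J j K₀ K₁) (i : Fin (s + 1)) (m : Fin (j + 2)) :
    hasA (initialIndices e K₁) i (j + 1) m = 1 := by
  rw [hasA, if_pos]
  exact h.full (mem_fullIndices.2 (by simp [lastLevel]))

lemma expect_hasB_succ_sub_le (h : IsWindow e c ε J j K₀ K₁) (i : Fin (s + 1)) {K : ℕ}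
    (h0 : K₀ ≤ K) (h1 : K < K₁) :
    𝔼 y : Word J, |hasB (initialIndices e (K + 1)) i j (y.extend j) (y.extend (j + 1)) -
      hasB (initialIndices e K) i j (y.extend j) (y.extend (j + 1))| ≤ 2 * ε := by
  refine (Finset.expect_le_expect fun y _ => ?_).trans (h.expect_term_le h0 h1 i.succ)
  rw [(initialIndices_succ_eq e K).1]
  exact abs_hasB_insert_sub_le _ _ _ _ _

/-- The additivity defect is at most `4ε` and enters `rowOscillation_dichotomy` with the factor `3`;
the steps `2ε` are at most `1/4`. -/
lemma dichotomy (h : IsWindow e c ε J j K₀ K₁) {t : ℝ} (ht : 0 < t) (hε : ε ≤ 1 / 8)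
    (hεt : 12 * ε ≤ t ^ 2) (i : Fin (s + 1)) :
    (∀ K, K₀ ≤ K → K ≤ K₁ → rowOscillation (hasB (initialIndices e K) i j) ≤ 16 * t) ∨
    (∀ K, K₀ ≤ K → K ≤ K₁ →
      rowOscillation (fun k m => hasB (initialIndices e K) i j m k) ≤ 16 * t) := by
  refine rowOscillation_dichotomy (fun K => hasB (initialIndices e K) i j)
    (fun K => hasB_eq _ i j) h.le ?_ (h.hasB_start i) (h.hasB_end i) ?_ ht ?_
  · intro K L hKL m k
    unfold hasB
    have := @initialIndices_mono _ e _ _ hKL ((i, .inr ⟨j, (m, k)⟩) : FamilyIndex s)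
    split_ifs with h1 h2
    · exact le_rfl
    · exact absurd (this h1) h2
    · exact zero_le_one
    · exact le_rfl
  · intro K h0 h1
    rw [← Word.expect_digit₂ h.lt fun m k =>
      |hasB (initialIndices e (K + 1)) i j m k - hasB (initialIndices e K) i j m k|]
    linarith [h.expect_hasB_succ_sub_le i h0 h1]
  · intro K h0 h1
    linarith [additivityDefect_hasB_le _ i h.lt (h.close K h0 h1 i.succ)]

lemma expect_filter_sub_le (h : IsWindow e c ε J j K₀ K₁) (P : FamilyIndex s → Prop)
    [DecidablePred P] {K : ℕ} (h0 : K₀ ≤ K) (h1 : K < K₁) (q : Fin (s + 2)) :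
    𝔼 y : Word J, |partialSum ((initialIndices e (K + 1)).filter P) q y.extend -
      partialSum ((initialIndices e K).filter P) q y.extend| ≤ 2 * ε := by
  refine (Finset.expect_le_expect fun y _ => ?_).trans (h.expect_term_le h0 h1 q)
  rw [(initialIndices_succ_eq e K).1]
  exact partialSum_insert_filter _ (initialIndices_succ_eq e K).2 P q _

lemma leftSum_end (h : IsWindow e c ε J j K₀ K₁) (i : Fin (s + 1)) (y : Digits) :
    leftSum (initialIndices e K₁) i.succ j y = 1 := by
  rw [leftSum_of_fullIndices_subset]
  · rfl
  · exact subset_trans (fun p hp => mem_fullIndices.2 ((mem_fullIndices.1 hp).trans (by omega)))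
      h.full

/-- The left sum is followed through the window. At `K₀` it is the whole partial sum, close to `z`;
at `K₁` it is a complete telescoping sum with value `1`. Being nearly constant and integer-valued in
between, it cannot change its integer. -/
lemma eq_one_of_row (h : IsWindow e c ε J j K₀ K₁) {i : Fin (s + 1)} {t : ℝ} {z : ℤ}
    (hz : c i.succ = z) (ht : 2 * ε + 16 * t ≤ 1 / 8) (ht0 : 0 ≤ t)
    (hrow : ∀ K, K₀ ≤ K → K ≤ K₁ → rowOscillation (hasB (initialIndices e K) i j) ≤ 16 * t) :
    z = 1 := by
  have hε : 0 ≤ ε := (Finset.expect_nonneg fun _ _ => abs_nonneg _).trans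
    (h.close K₀ le_rfl h.le 0)
  refine eq_of_small_oscillation
    (fun K (y : Word J) => leftSum (initialIndices e K) i.succ j y.extend)
    (fun K y => exists_partialSum_eq_int _ i _) h.le ht ?_ ?_ ?_ ?_
  · intro K h0 h1
    linarith [leftSum_oscillation_le _ i h.lt (h.close K h0 h1 i.succ), hrow K h0 h1]
  · intro K h0 h1
    have := h.expect_filter_sub_le (fun p => lastLevel p.2 ≤ j) h0 h1 i.succ
    simp only [leftSum]
    linarith
  · have h1 := h.close K₀ le_rfl h.le i.succ
    have h2 : (initialIndices e K₀).filter (fun p => lastLevel p.2 ≤ j) = initialIndices e K₀ :=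
      Finset.filter_true_of_mem fun p hp => (h.start p hp).le
    simp only [leftSum, h2, ← hz]
    linarith
  · simp only [h.leftSum_end, Int.cast_one, sub_self, abs_zero, Finset.expect_const_zero]
    positivity

/-- Now the followed quantity contains the functions starting at level `j` or before, that is, the
left sum minus `hasB`. It starts near `z` and ends at `1 - 1`. -/
lemma eq_zero_of_column (h : IsWindow e c ε J j K₀ K₁) {i : Fin (s + 1)} {t : ℝ} {z : ℤ}
    (hz : c i.succ = z) (ht : 2 * ε + 16 * t ≤ 1 / 8) (ht0 : 0 ≤ t)
    (hcol : ∀ K, K₀ ≤ K → K ≤ K₁ →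
      rowOscillation (fun k m => hasB (initialIndices e K) i j m k) ≤ 16 * t) :
    z = 0 := by
  have hε : 0 ≤ ε := (Finset.expect_nonneg fun _ _ => abs_nonneg _).trans
    (h.close K₀ le_rfl h.le 0)
  refine eq_of_small_oscillation
    (fun K (y : Word J) => partialSum ((initialIndices e K).filter fun p => firstLevel p.2 ≤ j)
      i.succ y.extend)
    (fun K y => exists_partialSum_eq_int _ i _) h.le ht ?_ ?_ ?_ ?_
  · intro K h0 h1
    simp only [partialSum_filter_firstLevel]
    linarith [leftSum_sub_hasB_oscillation_le _ i h.lt (h.close K h0 h1 i.succ), hcol K h0 h1]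
  · intro K h0 h1
    have := h.expect_filter_sub_le (fun p => firstLevel p.2 ≤ j) h0 h1 i.succ
    linarith
  · have h1 := h.close K₀ le_rfl h.le i.succ
    have h2 : (initialIndices e K₀).filter (fun p => firstLevel p.2 ≤ j) = initialIndices e K₀ :=
      Finset.filter_true_of_mem fun p hp => (firstLevel_le_lastLevel _).trans (h.start p hp).le
    simp only [h2, ← hz]
    linarith
  · simp only [partialSum_filter_firstLevel, h.leftSum_end, h.hasB_end, Int.cast_zero, sub_self,
      abs_zero, Finset.expect_const_zero]
    positivity

/-- On the coupling cube the integer-valued quantity `φ` is nearly constant at each time of the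
window. It is `0` when neither the `b j m k` nor the `a (j + 1) k` have appeared and `T.card - 1`
when all of them have. -/
lemma card_eq_one (h : IsWindow e c ε J j K₀ K₁) {t : ℝ} (ht0 : 0 ≤ t)
    (ht : 2 * (s + 2) * ε + 32 * (s + 1) * t ≤ 1 / 8) (T : Finset (Fin (s + 1)))
    (hrow : ∀ i ∈ T, ∀ K, K₀ ≤ K → K ≤ K₁ →
      rowOscillation (hasB (initialIndices e K) i j) ≤ 16 * t)
    (hcol : ∀ i ∉ T, ∀ K, K₀ ≤ K → K ≤ K₁ →
      rowOscillation (fun k m => hasB (initialIndices e K) i j m k) ≤ 16 * t) : T.card = 1 := by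
  have hε : 0 ≤ ε := (Finset.expect_nonneg fun _ _ => abs_nonneg _).trans
    (h.close K₀ le_rfl h.le 0)
  have hs : (0 : ℝ) ≤ s := Nat.cast_nonneg s
  have hη : 0 ≤ 2 * (s + 2) * ε + 32 * (s + 1) * t := by positivity
  let φ : ℕ → Fin (j + 1) → Fin (j + 2) → ℝ := fun K m k =>
    (∑ i ∈ T, hasB (initialIndices e K) i j m k) -
      hasA (initialIndices e K) (Fin.last s) (j + 1) k
  have key : (0 : ℤ) = (T.card : ℤ) - 1 := by
    refine eq_of_small_oscillation
      (fun K (y : Word J) => φ K (y.extend j) (y.extend (j + 1))) ?_ h.le ht ?_ ?_ ?_ ?_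
    · intro K y
      refine ⟨(∑ i ∈ T, if ((i, .inr ⟨j, (y.extend j, y.extend (j + 1))⟩) : FamilyIndex s) ∈
        initialIndices e K then 1 else 0) - if ((Fin.last s, .inl ⟨j + 1, y.extend (j + 1)⟩) :
          FamilyIndex s) ∈ initialIndices e K then 1 else 0, ?_⟩
      simp only [φ, hasB, hasA]
      push_cast
      rfl
    · intro K h0 h1
      rw [Word.expect_digit₂ h.lt fun m k => 𝔼 x' : Word J,
        |φ K m k - φ K (x'.extend j) (x'.extend (j + 1))|]
      have e1 : ∀ m k, 𝔼 x' : Word J, |φ K m k - φ K (x'.extend j) (x'.extend (j + 1))| =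
          𝔼 m', 𝔼 k', |φ K m k - φ K m' k'| := fun m k =>
        Word.expect_digit₂ h.lt fun m' k' => |φ K m k - φ K m' k'|
      simp only [e1]
      have h2 := expect_coupled_oscillation_le (fun i => hasB (initialIndices e K) i j)
        (hasA (initialIndices e K) (Fin.last s) (j + 1)) T
        (coupling_oscillation_le _ h.lt (h.close K h0 h1 0)) (by positivity : 0 ≤ 16 * t)
        (fun i hi => hrow i hi K h0 h1) (fun i hi => hcol i hi K h0 h1)
      rw [Fintype.card_fin] at h2
      push_cast at h2
      refine h2.trans ?_
      nlinarith
    · intro K h0 h1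
      have h2 : ∀ y : Word J, |φ (K + 1) (y.extend j) (y.extend (j + 1)) -
          φ K (y.extend j) (y.extend (j + 1))| ≤ ∑ i ∈ T,
          |hasB (initialIndices e (K + 1)) i j (y.extend j) (y.extend (j + 1)) -
            hasB (initialIndices e K) i j (y.extend j) (y.extend (j + 1))| +
            |term (e K) (Fin.last s).succ y.extend| := by
        intro y
        have h3 := abs_hasA_insert_sub_le (initialIndices e K) (e K) (Fin.last s) (j + 1) y.extend
        rw [← (initialIndices_succ_eq e K).1] at h3
        refine le_trans ?_ (add_le_add (Finset.abs_sum_le_sum_abs _ _) h3)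
        refine le_trans (le_of_eq ?_) (abs_sub _ _)
        simp only [φ, Finset.sum_sub_distrib]
        ring_nf
      refine (Finset.expect_le_expect fun y _ => h2 y).trans ?_
      rw [Finset.expect_add_distrib, Finset.expect_sum_comm]
      have h4 := h.expect_term_le h0 h1 (Fin.last s).succ
      have h5 : ∑ i ∈ T, 𝔼 y : Word J,
          |hasB (initialIndices e (K + 1)) i j (y.extend j) (y.extend (j + 1)) -
            hasB (initialIndices e K) i j (y.extend j) (y.extend (j + 1))| ≤ (s + 1) * (2 * ε) := by
        refine (Finset.sum_le_sum fun i _ => h.expect_hasB_succ_sub_le i h0 h1).trans ?_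
        rw [Finset.sum_const, nsmul_eq_mul]
        have : (T.card : ℝ) ≤ s + 1 := by
          have := Finset.card_le_univ T
          rw [Fintype.card_fin] at this
          exact_mod_cast this
        gcongr
      have : 0 ≤ 32 * ((s : ℝ) + 1) * t := by positivity
      linarith
    · simpa [φ, h.hasB_start, h.hasA_start] using hη
    · simpa [φ, h.hasB_end, h.hasA_end] using hη
  omega

end IsWindow

/-- The only possible limits of rearrangements with constant values on all cubes. -/
theorem ConvergesOnDigits.exists_eq_limitValue {e : ℕ ≃ FamilyIndex s} {c : Fin (s + 2) → ℝ}
    (h : ConvergesOnDigits e c) : ∃ i₀, c = limitValue i₀ := by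
  classical
  have hs : (0 : ℝ) ≤ s := Nat.cast_nonneg s
  -- `t` is a small multiple of `1/(s+2)`, so that the errors of all families together stay below
  -- `1/8`; the window width `t ^ 2 / 12` is what `IsWindow.dichotomy` requires.
  obtain ⟨t, ht⟩ : ∃ t : ℝ, t = 1 / (1000 * (s + 2)) := ⟨_, rfl⟩
  have ht0 : 0 < t := by rw [ht]; positivity
  have ht1 : t * (s + 2) = 1 / 1000 := by rw [ht]; field_simp
  have ht2 : t ≤ 1 / 1000 := by nlinarith
  obtain ⟨J, j, K₀, K₁, hw⟩ := h.exists_isWindow (ε := t ^ 2 / 12) (by positivity)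
  have hsmall : t ^ 2 / 12 ≤ t := by nlinarith
  have hs2 : 2 * (s + 2) * (t ^ 2 / 12) + 32 * (s + 1) * t ≤ 1 / 8 := by nlinarith
  have hs1 : 2 * (t ^ 2 / 12) + 16 * t ≤ 1 / 8 := by nlinarith
  have hd := hw.dichotomy ht0 (by linarith) (by linarith)
  let T : Finset (Fin (s + 1)) := Finset.univ.filter fun i => ∀ K, K₀ ≤ K → K ≤ K₁ →
    rowOscillation (hasB (initialIndices e K) i j) ≤ 16 * t
  have hT : ∀ i ∈ T, ∀ K, K₀ ≤ K → K ≤ K₁ →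
      rowOscillation (hasB (initialIndices e K) i j) ≤ 16 * t := fun i hi =>
    (Finset.mem_filter.1 hi).2
  have hT' : ∀ i ∉ T, ∀ K, K₀ ≤ K → K ≤ K₁ →
      rowOscillation (fun k m => hasB (initialIndices e K) i j m k) ≤ 16 * t := fun i hi =>
    (hd i).resolve_left fun h => hi (Finset.mem_filter.2 ⟨Finset.mem_univ i, h⟩)
  obtain ⟨i₀, hi₀⟩ := Finset.card_eq_one.1 (hw.card_eq_one ht0.le hs2 T hT hT')
  have hc : ∀ i : Fin (s + 1), c i.succ = if i = i₀ then 1 else 0 := by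
    intro i
    obtain ⟨z, hz⟩ := h.exists_eq_int i
    rw [hz]
    split_ifs with hi
    · have := hw.eq_one_of_row hz hs1 ht0.le (hT i (by rw [hi₀, hi]; simp))
      simp [this]
    · have := hw.eq_zero_of_column hz hs1 ht0.le (hT' i (by rw [hi₀]; simpa using hi))
      simp [this]
  refine ⟨i₀, funext fun q => Fin.cases ?_ (fun i => ?_) q⟩
  · rw [h.zero_eq]
    simp [hc, limitValue]
  · rw [hc i]
    rfl

end Rigidity

/-! ### From the cube with its product measure to digit words. -/

section CubeDigits

/-- The `n`-th digit of a point of the unit interval which is divided into `n + 1` equal parts. -/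
noncomputable def unitDigit (n : ℕ) (x : unitInterval) : Fin (n + 1) :=
  ⟨⌈((n : ℝ) + 1) * x⌉₊ - 1, by
    have h : ⌈((n : ℝ) + 1) * x⌉₊ ≤ n + 1 := Nat.ceil_le.2 (by
      push_cast
      exact mul_le_of_le_one_right (by positivity) x.2.2)
    omega⟩

lemma measurable_unitDigit (n : ℕ) : Measurable (unitDigit n) := by
  refine measurable_to_countable' fun m => ?_
  have h : Measurable fun x : unitInterval => ⌈((n : ℝ) + 1) * x⌉₊ - 1 :=
    (measurable_from_top (f := fun k : ℕ => k - 1)).comp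
      (Nat.measurable_ceil.comp (measurable_const.mul measurable_subtype_coe))
  have e : unitDigit n ⁻¹' {m} = (fun x : unitInterval => ⌈((n : ℝ) + 1) * x⌉₊ - 1) ⁻¹' {m.1} := by
    ext x
    simp [unitDigit, Fin.ext_iff]
  rw [e]
  exact h (measurableSet_singleton _)

lemma volume_unitDigit_preimage (n : ℕ) (m : Fin (n + 1)) :
    volume (unitDigit n ⁻¹' {m}) = ((n : ENNReal) + 1)⁻¹ := by
  have hn : (0 : ℝ) < (n : ℝ) + 1 := by positivity
  have hm : ((m : ℕ) : ℝ) + 1 ≤ (n : ℝ) + 1 := by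
    have : (m : ℕ) + 1 ≤ n + 1 := m.2
    exact_mod_cast this
  let a : unitInterval := ⟨(m : ℕ) / ((n : ℝ) + 1), by positivity, by
    rw [div_le_one hn]; linarith⟩
  let b : unitInterval := ⟨((m : ℕ) + 1) / ((n : ℝ) + 1), by positivity, by
    rw [div_le_one hn]; exact hm⟩
  have h1 : unitDigit n ⁻¹' {m} =ᵐ[volume] Set.Ioc a b := by
    -- At `0` the truncated subtraction gives the digit `0`, although `0` lies in none of the
    -- half-open intervals.
    have h0 : ∀ᵐ x : unitInterval, x ≠ 0 := compl_mem_ae_iff.2 (measure_singleton 0)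
    filter_upwards [h0] with x hx
    have hx0 : 0 < (x : ℝ) := lt_of_le_of_ne x.2.1 fun h => hx (Subtype.ext h.symm)
    have hpos : 0 < ⌈((n : ℝ) + 1) * x⌉₊ := Nat.ceil_pos.2 (by positivity)
    have h2 : unitDigit n x = m ↔ ⌈((n : ℝ) + 1) * x⌉₊ = (m : ℕ) + 1 := by
      rw [Fin.ext_iff]
      simp only [unitDigit]
      omega
    refine propext ?_
    change unitDigit n x = m ↔ a < x ∧ x ≤ b
    rw [h2, Nat.ceil_eq_iff (by omega), ← Subtype.coe_lt_coe, ← Subtype.coe_le_coe]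
    simp only [a, b]
    rw [div_lt_iff₀ hn, le_div_iff₀ hn, mul_comm (x : ℝ)]
    simp
  rw [measure_congr h1, unitInterval.volume_Ioc]
  simp only [a, b]
  rw [← sub_div, add_sub_cancel_left, one_div, ENNReal.ofReal_inv_of_pos hn,
    ENNReal.ofReal_add (by positivity) zero_le_one]
  simp

instance : IsProbabilityMeasure cubeMeasure := by unfold cubeMeasure; infer_instance

/-- The digits of the coordinates of a point of the cube. -/
noncomputable def cubeDigits (x : HilbertCube) : Digits := fun n => unitDigit n (x n)

lemma measurable_cubeDigits : Measurable cubeDigits :=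
  measurable_pi_lambda _ fun n => (measurable_unitDigit n).comp (measurable_pi_apply n)

/-- The first `J` digits of a random point are independent and uniform, so a function of them is
integrated by averaging over words. -/
lemma integral_comp_cubeDigits (J : ℕ) (h : Digits → ℝ)
    (hJ : ∀ y y' : Digits, (∀ n < J, y n = y' n) → h y = h y') :
    ∫ x, h (cubeDigits x) ∂cubeMeasure = 𝔼 y : Word J, h y.extend := by
  let r : HilbertCube → Word J := fun x n => cubeDigits x n
  have hr : Measurable r := measurable_pi_lambda _ fun n =>
    (measurable_pi_apply (n : ℕ)).comp measurable_cubeDigits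
  have h1 : ∀ x, h (cubeDigits x) = h (r x).extend := fun x =>
    hJ _ _ fun n hn => by simp [Word.extend, hn, r]
  have h2 : ∀ y : Word J, (cubeMeasure.map r).real {y} = 1 / Fintype.card (Word J) := by
    intro y
    have e : r ⁻¹' {y} = Set.pi (Finset.range J : Set ℕ) fun n => unitDigit n ⁻¹' {y.extend n} := by
      ext x
      simp only [Set.mem_preimage, Set.mem_singleton_iff, Set.mem_pi, Finset.coe_range, Set.mem_Iio]
      constructor
      · intro hx n hn
        rw [← hx]
        simp [Word.extend, hn, r, cubeDigits]
      · intro hx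
        funext n
        have := hx n n.2
        simpa [Word.extend, r, cubeDigits] using this
    rw [measureReal_def, Measure.map_apply hr (measurableSet_singleton y), e, cubeMeasure,
      Measure.infinitePi_pi _ fun n _ => measurable_unitDigit n (measurableSet_singleton _)]
    simp only [volume_unitDigit_preimage]
    rw [ENNReal.toReal_prod, Fintype.card_pi, Finset.prod_range]
    simp only [Fintype.card_fin, one_div]
    push_cast
    rw [← Finset.prod_inv_distrib]
    refine Finset.prod_congr rfl fun n _ => ?_
    rw [ENNReal.toReal_inv, ENNReal.toReal_add (by simp) (by simp)]
    simp
  have h3 : IsProbabilityMeasure (cubeMeasure.map r) := Measure.isProbabilityMeasure_map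
    hr.aemeasurable
  simp only [h1]
  rw [← integral_map (φ := r) (f := fun y => h y.extend) hr.aemeasurable
    (measurable_of_finite _).aestronglyMeasurable, integral_fintype Integrable.of_finite,
    Fintype.expect_eq_sum_div_card, Finset.sum_div]
  refine Finset.sum_congr rfl fun y _ => ?_
  rw [h2, smul_eq_mul]
  ring

end CubeDigits

/-! ### The series in L¹ and the form of its limits. -/

section SeriesTerms

variable {s : ℕ}

instance (N : ℕ) : IsFiniteMeasure (cubeUnionMeasure N) := by
  unfold cubeUnionMeasure; infer_instance

/-- The functions of the series on the union of cubes. -/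
noncomputable def seriesTerm (p : FamilyIndex s) (z : CubeUnion (s + 1)) : ℝ :=
  term p z.1 (cubeDigits z.2)

lemma measurable_digitIndicator (n : ℕ) (m : Fin (n + 1)) : Measurable (digitIndicator n m) := by
  unfold digitIndicator
  exact Measurable.ite ((measurable_pi_apply (X := fun n => Fin (n + 1)) n)
    (measurableSet_singleton m)) measurable_const measurable_const

lemma digitIndicator_mem (n : ℕ) (m : Fin (n + 1)) (y : Digits) :
    0 ≤ digitIndicator n m y ∧ digitIndicator n m y ≤ 1 := by
  unfold digitIndicator; split_ifs <;> simp

lemma measurable_term (p : FamilyIndex s) (q : Fin (s + 2)) : Measurable (term p q) := by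
  obtain ⟨i', ⟨n, m⟩ | ⟨n, m, k⟩⟩ := p
  · refine Fin.cases ?_ (fun i => ?_) q
    · change Measurable fun y => if i' = Fin.last s then -digitIndicator n m y else _
      split_ifs
      · exact (measurable_digitIndicator n m).neg
      · exact measurable_const
    · change Measurable fun y => if i = i' then digitIndicator n m y else 0
      split_ifs
      · exact measurable_digitIndicator n m
      · exact measurable_const
  · refine Fin.cases ?_ (fun i => ?_) q
    · exact (measurable_digitIndicator (n + 1) k).div_const _
    · change Measurable fun y => if i = i' then -(digitIndicator n m y * digitIndicator (n + 1) k y) else 0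
      split_ifs
      · exact ((measurable_digitIndicator n m).mul (measurable_digitIndicator (n + 1) k)).neg
      · exact measurable_const

lemma abs_term_le (p : FamilyIndex s) (q : Fin (s + 2)) (y : Digits) : |term p q y| ≤ 1 := by
  obtain ⟨i, ⟨n, m⟩ | ⟨n, m, k⟩⟩ := p
  · have h := digitIndicator_mem n m y
    refine Fin.cases ?_ (fun i => ?_) q
    · simp only [term_zero, couplingTerm]
      split_ifs
      · rw [abs_neg, abs_of_nonneg h.1]; exact h.2
      · rw [abs_neg, abs_of_nonneg (by positivity), div_le_one (by positivity)]
        linarith [(Nat.cast_nonneg n : (0 : ℝ) ≤ n)]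
    · simp only [term_succ, kadetsTerm]
      split_ifs
      · rw [abs_of_nonneg h.1]; exact h.2
      · simp
  · have h := digitIndicator_mem n m y
    have h' := digitIndicator_mem (n + 1) k y
    refine Fin.cases ?_ (fun i => ?_) q
    · simp only [term_zero, couplingTerm]
      rw [abs_of_nonneg (div_nonneg h'.1 (by positivity)), div_le_one (by positivity)]
      linarith [(Nat.cast_nonneg n : (0 : ℝ) ≤ n)]
    · simp only [term_succ, kadetsTerm]
      split_ifs
      · rw [abs_neg, abs_of_nonneg (mul_nonneg h.1 h'.1)]
        exact mul_le_one₀ h.2 h'.1 h'.2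
      · simp

lemma integrable_term_comp (p : FamilyIndex s) (q : Fin (s + 2)) :
    Integrable (fun x => term p q (cubeDigits x)) cubeMeasure :=
  Integrable.of_bound ((measurable_term p q).comp measurable_cubeDigits).aestronglyMeasurable 1
    (ae_of_all _ fun _ => abs_term_le _ _ _)

lemma integrable_partialSum_comp (U : Finset (FamilyIndex s)) (q : Fin (s + 2)) :
    Integrable (fun x => partialSum U q (cubeDigits x)) cubeMeasure :=
  integrable_finsetSum U fun p _ => integrable_term_comp p q

lemma integrable_seriesTerm (p : FamilyIndex s) :
    Integrable (seriesTerm p) (cubeUnionMeasure (s + 1)) := by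
  refine Integrable.of_bound (Measurable.aestronglyMeasurable ?_) 1
    (ae_of_all _ fun _ => abs_term_le _ _ _)
  exact measurable_from_prod_countable_right fun q =>
    (measurable_term p q).comp measurable_cubeDigits

lemma integral_cubeUnion {N : ℕ} {f : CubeUnion N → ℝ} (hf : Integrable f (cubeUnionMeasure N)) :
    ∫ z, f z ∂cubeUnionMeasure N = ∑ q, ∫ x, f (q, x) ∂cubeMeasure := by
  rw [cubeUnionMeasure, integral_prod f hf, integral_count]

/-- For the counting measure, almost every cube means every cube. -/
lemma integrable_section {N : ℕ} {f : CubeUnion N → ℝ} (hf : Integrable f (cubeUnionMeasure N))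
    (q : Fin (N + 1)) : Integrable (fun x => f (q, x)) cubeMeasure := by
  have := hf.prod_right_ae
  rw [ae_iff, Measure.count_eq_zero_iff] at this
  by_contra h
  exact Set.notMem_empty q (this ▸ h)

/-- The functions of the series as elements of `L¹`. -/
noncomputable def seriesElement (p : FamilyIndex s) : Lp ℝ 1 (cubeUnionMeasure (s + 1)) :=
  (integrable_seriesTerm p).toL1 (seriesTerm p)

lemma sum_seriesElement (U : Finset (FamilyIndex s)) :
    ∑ p ∈ U, seriesElement p =
      (integrable_finsetSum U fun p _ => integrable_seriesTerm p).toL1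
        (fun z => ∑ p ∈ U, seriesTerm p z) := by
  classical
  induction U using Finset.induction_on with
  | empty =>
    simp only [Finset.sum_empty]
    exact (Integrable.toL1_zero _).symm
  | insert p U hp ih =>
    rw [Finset.sum_insert hp, ih, seriesElement, ← Integrable.toL1_add]
    congr 1
    funext z
    simp [Finset.sum_insert hp]

lemma norm_toL1_eq_sum {N : ℕ} {f : CubeUnion N → ℝ} (hf : Integrable f (cubeUnionMeasure N)) :
    ‖hf.toL1 f‖ = ∑ q, ∫ x, |f (q, x)| ∂cubeMeasure := by
  rw [L1.norm_of_fun_eq_integral_norm, integral_cubeUnion hf.norm]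
  rfl

lemma integrable_const_fst {N : ℕ} (c : Fin (N + 1) → ℝ) :
    Integrable (fun z : CubeUnion N => c z.1) (cubeUnionMeasure N) :=
  Integrable.of_finite.comp_fst (μ := Measure.count) (f := c) cubeMeasure

/-- The function with the value `c q` on the cube `q`. -/
noncomputable def cubewiseConst {N : ℕ} (c : Fin (N + 1) → ℝ) : Lp ℝ 1 (cubeUnionMeasure N) :=
  (integrable_const_fst c).toL1 (fun z => c z.1)

lemma integral_abs_sub_le {f g h : HilbertCube → ℝ} (hf : Integrable f cubeMeasure)
    (hg : Integrable g cubeMeasure) (hh : Integrable h cubeMeasure) :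
    ∫ x, |f x - h x| ∂cubeMeasure ≤
      ∫ x, |f x - g x| ∂cubeMeasure + ∫ x, |g x - h x| ∂cubeMeasure :=
  (integral_mono (hf.sub hh).abs ((hf.sub hg).abs.add (hg.sub hh).abs) fun _ =>
    abs_sub_le _ _ _).trans_eq (integral_add (hf.sub hg).abs (hg.sub hh).abs)

lemma norm_sum_seriesElement_sub (U : Finset (FamilyIndex s)) {g : CubeUnion (s + 1) → ℝ}
    (hg : Integrable g (cubeUnionMeasure (s + 1))) :
    ‖∑ p ∈ U, seriesElement p - hg.toL1 g‖ =
      ∑ q, ∫ x, |partialSum U q (cubeDigits x) - g (q, x)| ∂cubeMeasure := by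
  rw [sum_seriesElement, ← Integrable.toL1_sub, norm_toL1_eq_sum]
  rfl

/-- A limit of partial sums is nearly constant on every cube. -/
lemma exists_integral_sub_const_le {e : ℕ ≃ FamilyIndex s} {g : HilbertCube → ℝ} {q : Fin (s + 2)}
    (hg : Integrable g cubeMeasure) {ε : ℝ} {K₀ : ℕ} (h : ∀ K ≥ K₀,
      ∫ x, |partialSum (initialIndices e K) q (cubeDigits x) - g x| ∂cubeMeasure ≤ ε) :
    ∃ a, ∫ x, |g x - a| ∂cubeMeasure ≤ 3 * ε := by
  obtain ⟨j, hj⟩ := exists_lastLevel_lt (initialIndices e K₀)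
  obtain ⟨K', hK'⟩ := exists_subset_initialIndices e (fullIndices s (j + 1))
  obtain ⟨K₁, hK₁⟩ : ∃ K₁, K₁ = max K' K₀ := ⟨_, rfl⟩
  have hfull : fullIndices s (j + 1) ⊆ initialIndices e K₁ :=
    hK'.trans (initialIndices_mono e (by omega))
  obtain ⟨J, hJ⟩ := exists_lastLevel_lt (initialIndices e K₁)
  let S₀ : Digits → ℝ := partialSum (initialIndices e K₀) q
  let S₁ : Digits → ℝ := partialSum (initialIndices e K₁) q
  have hi₀ : Integrable (fun x => S₀ (cubeDigits x)) cubeMeasure := integrable_partialSum_comp _ q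
  have hi₁ : Integrable (fun x => S₁ (cubeDigits x)) cubeMeasure := integrable_partialSum_comp _ q
  have hS₀ : ∀ y y' : Digits, (∀ n ≤ j, y n = y' n) → S₀ y = S₀ y' := fun y y' hy =>
    partialSum_congr _ _ fun p hp n _ h2 => hy n (h2.trans (hj p hp).le)
  -- By time `K₁` everything up to level `j + 1` is present and sums to a constant. Any other
  -- function reaches beyond `j + 1`, and since a function involves at most two consecutive levels,
  -- it starts beyond `j`.
  have hS₁ : ∀ y y' : Digits, (∀ n, j < n → y n = y' n) → S₁ y = S₁ y' := by
    intro y y' hy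
    have hsplit : ∀ y, S₁ y = leftSum (initialIndices e K₁) q (j + 1) y +
        partialSum ((initialIndices e K₁).filter fun p => ¬ lastLevel p.2 ≤ j + 1) q y := fun y =>
      (Finset.sum_filter_add_sum_filter_not _ _ _).symm
    rw [hsplit, hsplit, leftSum_of_fullIndices_subset hfull, leftSum_of_fullIndices_subset hfull]
    congr 1
    refine partialSum_congr _ _ fun p hp n h1 _ => hy n (lt_of_lt_of_le ?_ h1)
    have h2 := (Finset.mem_filter.1 hp).2
    have h3 : lastLevel p.2 ≤ firstLevel p.2 + 1 := by
      rcases p.2 with p | p <;> simp [firstLevel, lastLevel]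
    omega
  have hdep : ∀ y y' : Digits, (∀ n < max J (j + 1), y n = y' n) → S₀ y = S₀ y' ∧ S₁ y = S₁ y' := by
    intro y y' hy
    refine ⟨hS₀ y y' fun n hn => hy n (by omega), partialSum_congr _ _ fun p hp n _ h2 => hy n ?_⟩
    have := hJ p hp
    omega
  have h1 : ∫ x, |S₀ (cubeDigits x) - S₁ (cubeDigits x)| ∂cubeMeasure ≤ 2 * ε := by
    have h2 := h K₀ le_rfl
    have h3 := h K₁ (by omega)
    have h4 := integral_abs_sub_le hi₀ hg hi₁
    simp only [abs_sub_comm (g _)] at h4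
    simp only [S₀, S₁] at *
    linarith
  -- `S₀` sees only the head and `S₁` only the tail, so after splicing they are independent. Some
  -- tail `x'` does at least as well as the average, and `S₁` at this tail is the required constant.
  rw [integral_comp_cubeDigits (max J (j + 1)) (fun y => |S₀ y - S₁ y|) fun y y' hy => by
      simp only [(hdep y y' hy).1, (hdep y y' hy).2], ← Word.expect_splice (fun y => |S₀ y - S₁ y|) j,
      Finset.expect_comm]
    at h1
  obtain ⟨x', -, hx'⟩ := Finset.exists_le_of_expect_le Finset.univ_nonempty h1
  refine ⟨S₁ x'.extend, ?_⟩
  have h5 : ∫ x, |S₀ (cubeDigits x) - S₁ x'.extend| ∂cubeMeasure ≤ 2 * ε := by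
    rw [integral_comp_cubeDigits (max J (j + 1)) (fun y => |S₀ y - S₁ x'.extend|) fun y y' hy => by
      simp only [(hdep y y' hy).1]]
    refine le_trans (le_of_eq ?_) hx'
    refine Finset.expect_congr rfl fun x _ => ?_
    rw [hS₀ (Digits.splice j x.extend x'.extend) x.extend fun n hn => by simp [Digits.splice, hn],
      hS₁ (Digits.splice j x.extend x'.extend) x'.extend fun n hn => by
        simp [Digits.splice, hn.not_ge]]
  have h6 := h K₀ le_rfl
  have h7 := integral_abs_sub_le hg hi₀ (integrable_const (S₁ x'.extend))
  simp only [abs_sub_comm (g _) (S₀ _)] at h7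
  simp only [S₀] at *
  linarith

/-- Any constant that approximates `g` up to `ε / 2` is itself within `ε / 2` of the mean, so the
mean approximates `g` up to every `ε`. -/
lemma integral_sub_integral_eq_zero {g : HilbertCube → ℝ} (hg : Integrable g cubeMeasure)
    (h : ∀ ε > 0, ∃ a, ∫ x, |g x - a| ∂cubeMeasure ≤ ε) :
    ∫ x, |g x - ∫ x, g x ∂cubeMeasure| ∂cubeMeasure = 0 := by
  refine le_antisymm (le_of_forall_pos_le_add fun ε hε => ?_)
    (integral_nonneg fun _ => abs_nonneg _)
  obtain ⟨a, ha⟩ := h (ε / 2) (by positivity)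
  have h1 : |a - ∫ x, g x ∂cubeMeasure| ≤ ε / 2 := by
    have : a - ∫ x, g x ∂cubeMeasure = -∫ x, (g x - a) ∂cubeMeasure := by
      rw [integral_sub hg (integrable_const _)]
      simp
    rw [this, abs_neg]
    exact (abs_integral_le_integral_abs).trans ha
  have h2 := integral_abs_sub_le hg (integrable_const a)
    (integrable_const (∫ x, g x ∂cubeMeasure))
  simp only [integral_const, probReal_univ, one_smul] at h2
  linarith

/-- The limits of convergent rearrangements of the series. -/
theorem exists_eq_cubewiseConst {e : ℕ ≃ FamilyIndex s} {f : Lp ℝ 1 (cubeUnionMeasure (s + 1))}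
    (hf : Tendsto (fun K => ∑ p ∈ initialIndices e K, seriesElement p) atTop (𝓝 f)) :
    ∃ i₀ : Fin (s + 1), f = cubewiseConst (limitValue i₀) := by
  have hfi : Integrable f (cubeUnionMeasure (s + 1)) := L1.integrable_coeFn f
  have hconv : ∀ ε > 0, ∃ K₀, ∀ K ≥ K₀, ∀ q,
      ∫ x, |partialSum (initialIndices e K) q (cubeDigits x) - f (q, x)| ∂cubeMeasure ≤ ε := by
    intro ε hε
    obtain ⟨K₀, hK₀⟩ := Metric.tendsto_atTop.1 hf ε hε
    refine ⟨K₀, fun K hK q => ?_⟩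
    have h1 := (hK₀ K hK).le
    have h2 := norm_sum_seriesElement_sub (initialIndices e K) hfi
    rw [Integrable.toL1_coeFn] at h2
    rw [dist_eq_norm, h2] at h1
    refine le_trans ?_ h1
    exact Finset.single_le_sum (f := fun q => ∫ x, |partialSum (initialIndices e K) q
      (cubeDigits x) - f (q, x)| ∂cubeMeasure)
      (fun q _ => integral_nonneg fun _ => abs_nonneg _) (Finset.mem_univ q)
  let c : Fin (s + 2) → ℝ := fun q => ∫ x, f (q, x) ∂cubeMeasure
  have hc : ∀ q, ∫ x, |f (q, x) - c q| ∂cubeMeasure = 0 := by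
    intro q
    refine integral_sub_integral_eq_zero (integrable_section hfi q) fun ε hε => ?_
    obtain ⟨K₀, hK₀⟩ := hconv (ε / 3) (by positivity)
    obtain ⟨a, ha⟩ := exists_integral_sub_const_le (integrable_section hfi q)
      (fun K hK => hK₀ K hK q)
    exact ⟨a, by linarith⟩
  have hfc : f = cubewiseConst c := by
    rw [← sub_eq_zero, ← norm_eq_zero, ← Integrable.toL1_coeFn f hfi, cubewiseConst,
      ← Integrable.toL1_sub, norm_toL1_eq_sum]
    exact Finset.sum_eq_zero fun q _ => hc q
  have hdigits : ConvergesOnDigits e c := by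
    intro ε hε
    obtain ⟨K₀, hK₀⟩ := hconv ε hε
    refine ⟨K₀, fun K hK q J hJ => ?_⟩
    rw [← integral_comp_cubeDigits J (fun y => |partialSum (initialIndices e K) q y - c q|)]
    · have h1 := integral_abs_sub_le (integrable_partialSum_comp (initialIndices e K) q)
        (integrable_section hfi q) (integrable_const (c q))
      rw [hc q, add_zero] at h1
      exact h1.trans (hK₀ K hK q)
    · intro y y' hy
      rw [partialSum_congr _ q fun p hp n _ h2 => hy n (h2.trans_lt (hJ p hp))]
  obtain ⟨i₀, hi₀⟩ := hdigits.exists_eq_limitValue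
  exact ⟨i₀, by rw [hfc, hi₀]⟩

end SeriesTerms

/-! ### Enumerating countable sets block by block. -/

section Enumeration

/-- A countable set which is divided into finite blocks can be enumerated block by block. -/
theorem exists_equiv_nat_monotone {ι : Type*} [Countable ι] [Infinite ι] (β : ι → ℕ)
    (Φ : ℕ → Finset ι) (hΦ : ∀ n i, i ∈ Φ n ↔ β i = n) : ∃ e : ℕ ≃ ι, Monotone (β ∘ e) := by
  obtain ⟨g, hg⟩ := exists_injective_nat ι
  -- `C n` exceeds all codes `g i` in block `n`. Shifting each block by the total size of the
  -- earlier ones makes the code `κ` injective and compatible with `β`.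
  let C : ℕ → ℕ := fun n => (Φ n).sup g + 1
  let κ : ι → ℕ := fun i => ∑ m ∈ Finset.range (β i), C m + g i
  have hκ : ∀ i i', β i < β i' → κ i < κ i' := by
    intro i i' h
    have h1 : g i < C (β i) := Nat.lt_succ_of_le (Finset.le_sup ((hΦ _ _).2 rfl))
    calc κ i < ∑ m ∈ Finset.range (β i + 1), C m := by
          rw [Finset.sum_range_succ]; exact Nat.add_lt_add_left h1 _
      _ ≤ ∑ m ∈ Finset.range (β i'), C m :=
          Finset.sum_le_sum_of_subset (Finset.range_mono h)
      _ ≤ κ i' := Nat.le_add_right _ _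
  have hinj : Function.Injective κ := by
    intro i i' h
    have hβ : β i = β i' := by
      rcases lt_trichotomy (β i) (β i') with h1 | h1 | h1
      · exact absurd h (hκ _ _ h1).ne
      · exact h1
      · exact absurd h (hκ _ _ h1).ne'
    simp only [κ, hβ] at h
    exact hg (Nat.add_left_cancel h)
  have hinf : Infinite (Set.range κ) := (Set.infinite_range_of_injective hinj).to_subtype
  classical
  refine ⟨(Nat.Subtype.orderIsoOfNat (Set.range κ)).toEquiv.trans
    (Equiv.ofInjective κ hinj).symm, fun a b hab => ?_⟩
  by_contra h
  have h1 := hκ _ _ (not_le.1 h)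
  have h2 : ∀ a, κ (((Nat.Subtype.orderIsoOfNat (Set.range κ)).toEquiv.trans
      (Equiv.ofInjective κ hinj).symm) a) = Nat.Subtype.orderIsoOfNat (Set.range κ) a := by
    intro a
    exact Equiv.apply_ofInjective_symm hinj _
  rw [h2, h2, Subtype.coe_lt_coe, OrderIso.lt_iff_lt] at h1
  omega

/-- A series converges if it does after grouping its terms into blocks with small sums of norms. -/
theorem tendsto_sum_of_blocks {ι E : Type*} [Infinite ι] [NormedAddCommGroup E] (f : ι → E)
    (β : ι → ℕ) (Φ : ℕ → Finset ι) (hΦ : ∀ n i, i ∈ Φ n ↔ β i = n) (e : ℕ ≃ ι)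
    (he : Monotone (β ∘ e)) {x : E}
    (hsum : Tendsto (fun N => ∑ n ∈ Finset.range N, ∑ i ∈ Φ n, f i) atTop (𝓝 x))
    (hnorm : Tendsto (fun n => ∑ i ∈ Φ n, ‖f i‖) atTop (𝓝 0)) :
    Tendsto (fun K => ∑ p ∈ initialIndices e K, f p) atTop (𝓝 x) := by
  classical
  have htop : Tendsto (β ∘ e) atTop atTop := by
    refine he.tendsto_atTop_atTop fun b => ?_
    by_contra! h
    have hfin : (Set.univ : Set ι).Finite := by
      refine ((Finset.range b).biUnion Φ).finite_toSet.subset fun i _ => ?_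
      have := h (e.symm i)
      simp only [Function.comp_apply, Equiv.apply_symm_apply] at this
      simp [hΦ, this]
    exact Set.infinite_univ hfin
  -- A partial sum consists of all complete blocks before that of the next term `e K`, and a part of
  -- the latter's block, which is bounded by the block's sum of norms.
  have hdec : ∀ K, ∑ p ∈ initialIndices e K, f p =
      ∑ n ∈ Finset.range (β (e K)), ∑ i ∈ Φ n, f i +
        ∑ p ∈ initialIndices e K with ¬ β p < β (e K), f p := by
    intro K
    rw [← Finset.sum_filter_add_sum_filter_not (initialIndices e K) fun p => β p < β (e K)]
    congr 1
    rw [← Finset.sum_fiberwise_of_maps_to (g := β) (t := Finset.range (β (e K)))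
      fun p hp => Finset.mem_range.2 (Finset.mem_filter.1 hp).2]
    refine Finset.sum_congr rfl fun n hn => Finset.sum_congr ?_ fun _ _ => rfl
    ext p
    simp only [Finset.mem_filter, hΦ, mem_initialIndices]
    refine ⟨fun h => h.2, fun h => ⟨⟨?_, by rw [h]; exact Finset.mem_range.1 hn⟩, h⟩⟩
    by_contra hK
    have := he (not_lt.1 hK)
    simp only [Function.comp_apply, Equiv.apply_symm_apply, h] at this
    exact absurd (Finset.mem_range.1 hn) (not_lt.2 this)
  simp only [hdec]
  rw [← add_zero x]
  refine (hsum.comp htop).add (squeeze_zero_norm (fun K => ?_) (hnorm.comp htop))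
  refine (norm_sum_le _ _).trans (Finset.sum_le_sum_of_subset_of_nonneg ?_ fun _ _ _ => norm_nonneg _)
  intro p hp
  simp only [Finset.mem_filter, mem_initialIndices] at hp
  have := he hp.1.le
  simp only [Function.comp_apply, Equiv.apply_symm_apply] at this
  exact (hΦ _ _).2 (le_antisymm this (not_lt.1 hp.2))

/-- An enumeration of the indices `(n, m)` in lexicographic order. -/
theorem exists_lex_enumeration : ∃ t : AIndex Cell ≃ ℕ,
    ∀ p q, t p < t q ↔ Sigma.Lex (· < ·) (fun _ => (· < ·)) p q := by
  -- Since `m ≤ n`, the value `n² + m` stays below `(n + 1)²`, so it increases strictly in the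
  -- lexicographic order.
  let β : AIndex Cell → ℕ := fun p => p.1 * p.1 + p.2.1
  have hlex : ∀ p q, Sigma.Lex (· < ·) (fun _ => (· < ·)) p q → β p < β q := by
    rintro _ _ (⟨a, b, h⟩ | ⟨a, b, h⟩)
    · rename_i i j
      have := a.2
      simp only [β]
      nlinarith
    · simpa [β] using h
  have htri : ∀ p q : AIndex Cell, Sigma.Lex (· < ·) (fun _ => (· < ·)) p q ∨ p = q ∨
      Sigma.Lex (· < ·) (fun _ => (· < ·)) q p := by
    rintro ⟨n, m⟩ ⟨n', m'⟩
    rcases lt_trichotomy n n' with h | rfl | h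
    · exact Or.inl (Sigma.Lex.left _ _ h)
    · rcases lt_trichotomy m m' with h | rfl | h
      · exact Or.inl (Sigma.Lex.right _ _ h)
      · exact Or.inr (Or.inl rfl)
      · exact Or.inr (Or.inr (Sigma.Lex.right _ _ h))
    · exact Or.inr (Or.inr (Sigma.Lex.left _ _ h))
  have hinj : Function.Injective β := by
    intro p q h
    rcases htri p q with h1 | h1 | h1
    · exact absurd h (hlex _ _ h1).ne
    · exact h1
    · exact absurd h (hlex _ _ h1).ne'
  have hfin : ∀ n, {p | β p = n}.Finite := fun n =>
    Set.Subsingleton.finite fun p hp q hq => hinj (hp.trans hq.symm)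
  have : Infinite (AIndex Cell) := Infinite.of_injective (fun n => (⟨n, 0⟩ : AIndex Cell))
    fun n n' h => congrArg Sigma.fst h
  obtain ⟨e, he⟩ := exists_equiv_nat_monotone β (fun n => (hfin n).toFinset) (by simp)
  have h1 : ∀ p q, Sigma.Lex (· < ·) (fun _ => (· < ·)) p q → e.symm p < e.symm q := by
    intro p q h
    by_contra hc
    have := he (not_lt.1 hc)
    simp only [Function.comp_apply, Equiv.apply_symm_apply] at this
    exact absurd (hlex p q h) (not_lt.2 this)
  refine ⟨e.symm, fun p q => ⟨fun h => ?_, h1 p q⟩⟩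
  rcases htri p q with h2 | h2 | h2
  · exact h2
  · exact absurd h (by simp [h2])
  · exact absurd h (h1 _ _ h2).not_gt

end Enumeration

/-! ### The standard rearrangements and their limits. -/

section StandardOrders

variable {s : ℕ}

/-- The member `a` of the `i`-th family which leads the member `b` in the standard order: the
`0`-order for `i ≠ i₀` and the `1`-order for `i = i₀`. -/
def leader (i₀ i : Fin (s + 1)) (b : BIndex Cell) : AIndex Cell :=
  if i = i₀ then ⟨b.1 + 1, b.2.2⟩ else ⟨b.1, b.2.1⟩

/-- The members `b` of the `i`-th family with the leader `p`. -/
def followers (i₀ i : Fin (s + 1)) (p : AIndex Cell) : Finset (BIndex Cell) :=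
  if i = i₀ then
    match p with
    | ⟨0, _⟩ => ∅
    | ⟨n + 1, m⟩ => Finset.univ.image fun l => ⟨n, (l, m)⟩
  else Finset.univ.image fun k => ⟨p.1, (p.2, k)⟩

lemma mem_followers {i₀ i : Fin (s + 1)} {p : AIndex Cell} {b : BIndex Cell} :
    b ∈ followers i₀ i p ↔ leader i₀ i b = p := by
  obtain ⟨n, m⟩ := p
  obtain ⟨n', m', k'⟩ := b
  unfold followers leader
  split_ifs with h
  · cases n with
    | zero => simp
    | succ n =>
      simp only [Finset.mem_image, Finset.mem_univ, true_and]
      constructor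
      · rintro ⟨l, hl⟩
        simp only [Sigma.mk.injEq] at hl
        obtain ⟨rfl, hl⟩ := hl
        simp only [heq_eq_eq, Prod.mk.injEq] at hl
        rw [hl.2]
      · intro hl
        simp only [Sigma.mk.injEq, Nat.add_right_cancel_iff] at hl
        obtain ⟨rfl, hl⟩ := hl
        exact ⟨m', by rw [heq_eq_eq] at hl; rw [hl]⟩
  · simp only [Finset.mem_image, Finset.mem_univ, true_and]
    constructor
    · rintro ⟨k, hk⟩
      simp only [Sigma.mk.injEq] at hk
      obtain ⟨rfl, hk⟩ := hk
      simp only [heq_eq_eq, Prod.mk.injEq] at hk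
      rw [hk.1]
    · intro hk
      simp only [Sigma.mk.injEq] at hk
      obtain ⟨rfl, hk⟩ := hk
      exact ⟨k', by rw [heq_eq_eq] at hk; rw [hk]⟩

lemma sum_followers_ne {E : Type*} [AddCommMonoid E] {i₀ i : Fin (s + 1)} (h : i ≠ i₀) (n : ℕ)
    (m : Fin (n + 1)) (f : BIndex Cell → E) :
    ∑ b ∈ followers i₀ i ⟨n, m⟩, f b = ∑ k, f ⟨n, (m, k)⟩ := by
  rw [followers.eq_def, if_neg h, Finset.sum_image]
  intro k _ k' _ hk
  simpa using hk

lemma sum_followers_succ {E : Type*} [AddCommMonoid E] (i₀ : Fin (s + 1)) (n : ℕ)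
    (m : Fin (n + 2)) (f : BIndex Cell → E) :
    ∑ b ∈ followers i₀ i₀ ⟨n + 1, m⟩, f b = ∑ l, f ⟨n, (l, m)⟩ := by
  rw [followers.eq_def, if_pos rfl, Finset.sum_image]
  intro k _ k' _ hk
  simpa using hk

lemma sum_followers_zero {E : Type*} [AddCommMonoid E] (i₀ : Fin (s + 1))
    (m : Fin (0 + 1)) (f : BIndex Cell → E) :
    ∑ b ∈ followers i₀ i₀ ⟨0, m⟩, f b = 0 := by
  simp [followers]

/-- The members `a` with the index `p` of all families, followed by the members `b` they lead. -/
def block (i₀ : Fin (s + 1)) (p : AIndex Cell) : Finset (FamilyIndex s) :=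
  (Finset.univ.sigma fun i => ({p} : Finset (AIndex Cell)).disjSum (followers i₀ i p)).map
    (Equiv.sigmaEquivProd _ _).toEmbedding

/-- The index of the block in which a function of the series appears. -/
def blockIndex (i₀ : Fin (s + 1)) : FamilyIndex s → AIndex Cell
  | (_, .inl p) => p
  | (i, .inr b) => leader i₀ i b

lemma mem_block {i₀ : Fin (s + 1)} {p : AIndex Cell} {x : FamilyIndex s} :
    x ∈ block i₀ p ↔ blockIndex i₀ x = p := by
  obtain ⟨i, x | x⟩ := x <;>
  simp [block, blockIndex, mem_followers]

lemma sum_block {E : Type*} [AddCommMonoid E] (i₀ : Fin (s + 1)) (p : AIndex Cell)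
    (f : FamilyIndex s → E) : ∑ x ∈ block i₀ p, f x =
      ∑ i, (f (i, .inl p) + ∑ b ∈ followers i₀ i p, f (i, .inr b)) := by
  rw [block, Finset.sum_map, Finset.sum_sigma]
  refine Finset.sum_congr rfl fun i _ => ?_
  rw [Finset.sum_disjSum]
  simp

lemma sum_ite_eq_const (a : Fin (s + 1)) (x z : ℝ) :
    ∑ i, (if i = a then x else z) = (x - z) + (s + 1) * z := by
  have : ∀ i : Fin (s + 1), (if i = a then x else z) = (if i = a then x - z else 0) + z := by
    intro i; split_ifs <;> ring
  simp only [this, Finset.sum_add_distrib, Finset.sum_ite_eq', Finset.mem_univ, if_true]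
  simp

lemma digitIndicator_zero (m : Fin (0 + 1)) (y : Digits) : digitIndicator 0 m y = 1 := by
  simp [digitIndicator, Subsingleton.elim (α := Fin 1) (y 0) m]

/-- The sums of the blocks, except for the first one, vanish. -/
lemma sum_block_term (i₀ : Fin (s + 1)) (p : AIndex Cell) (q : Fin (s + 2)) (y : Digits) :
    ∑ x ∈ block i₀ p, term x q y = if p.1 = 0 then limitValue i₀ q else 0 := by
  obtain ⟨n, m⟩ := p
  rw [sum_block]
  refine Fin.cases ?_ (fun i => ?_) q
  -- On the coupling cube the `a` contribute `-digitIndicator n m` once and `-1/(n+1)` `s` times.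
  -- The followers in family `i₀` cancel the former and those in the `s` other families the latter,
  -- whichever `i₀` is. At level `0` the followers in family `i₀` are missing, which leaves `-1`.
  · have h1 : ∀ i, ∑ b ∈ followers i₀ i ⟨n, m⟩, couplingTerm (i, .inr b) y =
        if i = i₀ then (if n = 0 then 0 else digitIndicator n m y) else 1 / ((n : ℝ) + 1) := by
      intro i
      split_ifs with hi hn
      · subst hi hn
        exact sum_followers_zero _ _ _
      · subst hi
        obtain ⟨n, rfl⟩ := Nat.exists_eq_succ_of_ne_zero hn
        rw [sum_followers_succ]
        simp only [couplingTerm, Finset.sum_const, Finset.card_univ, Fintype.card_fin, nsmul_eq_mul]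
        push_cast
        field_simp
      · rw [sum_followers_ne hi]
        simp only [couplingTerm, ← Finset.sum_div, sum_digitIndicator]
    simp only [term_zero, Finset.sum_add_distrib, h1]
    simp only [couplingTerm, sum_ite_eq_const]
    by_cases hn : n = 0
    · subst hn
      simp only [digitIndicator_zero, limitValue, if_true, Fin.cases_zero]
      push_cast
      ring
    · simp only [hn, if_false]
      ring
  · have h1 : ∀ i', term ((i', .inl ⟨n, m⟩) : FamilyIndex s) i.succ y +
        ∑ b ∈ followers i₀ i' ⟨n, m⟩, term ((i', .inr b) : FamilyIndex s) i.succ y =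
        if i = i' then (if i = i₀ ∧ n = 0 then 1 else 0) else 0 := by
      intro i'
      simp only [term_succ]
      by_cases hi : i = i'
      · subst hi
        simp only [if_true]
        by_cases hi₀ : i = i₀
        · subst hi₀
          cases n with
          | zero => rw [sum_followers_zero]; simp [kadetsTerm, digitIndicator_zero]
          | succ n =>
            rw [sum_followers_succ]
            simp only [kadetsTerm, Finset.sum_neg_distrib, ← Finset.sum_mul, sum_digitIndicator]
            simp
        · rw [sum_followers_ne hi₀]
          simp only [kadetsTerm, Finset.sum_neg_distrib, ← Finset.mul_sum, sum_digitIndicator]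
          simp [hi₀]
      · simp [hi]
    simp only [h1, Finset.sum_ite_eq, Finset.mem_univ, if_true, limitValue, Fin.cases_succ]
    by_cases hn : n = 0 <;> simp [hn]

lemma integral_digitIndicator (n : ℕ) (m : Fin (n + 1)) :
    ∫ x, digitIndicator n m (cubeDigits x) ∂cubeMeasure = 1 / ((n : ℝ) + 1) := by
  rw [integral_comp_cubeDigits (n + 1) (digitIndicator n m), expect_digitIndicator (by omega)]
  intro y y' h
  simp [digitIndicator, h n (by omega)]

lemma integral_digitIndicator_mul (n : ℕ) (m : Fin (n + 1)) (k : Fin (n + 2)) :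
    ∫ x, digitIndicator n m (cubeDigits x) * digitIndicator (n + 1) k (cubeDigits x) ∂cubeMeasure =
      1 / ((n : ℝ) + 1) * (1 / ((n : ℝ) + 2)) := by
  rw [integral_comp_cubeDigits (n + 2)
    (fun y => digitIndicator n m y * digitIndicator (n + 1) k y),
    expect_digitIndicator_mul (by omega)]
  intro y y' h
  simp [digitIndicator, h n (by omega), h (n + 1) (by omega)]

lemma norm_seriesElement_eq (x : FamilyIndex s) : ‖seriesElement x‖ =
    ∫ z, |couplingTerm x (cubeDigits z)| ∂cubeMeasure +
      ∫ z, |kadetsTerm x.2 (cubeDigits z)| ∂cubeMeasure := by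
  rw [seriesElement, norm_toL1_eq_sum, Fin.sum_univ_succ]
  congr 1
  rw [Finset.sum_eq_single x.1]
  · simp [seriesTerm]
  · intro i _ hi
    simp [seriesTerm, hi]
  · simp

lemma norm_seriesElement_inl (i : Fin (s + 1)) (n : ℕ) (m : Fin (n + 1)) :
    ‖seriesElement ((i, .inl ⟨n, m⟩) : FamilyIndex s)‖ = 2 * (1 / ((n : ℝ) + 1)) := by
  rw [norm_seriesElement_eq]
  have h1 : ∀ z, |digitIndicator n m (cubeDigits z)| = digitIndicator n m (cubeDigits z) :=
    fun z => abs_of_nonneg (digitIndicator_mem n m _).1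
  have h2 : |1 / ((n : ℝ) + 1)| = 1 / ((n : ℝ) + 1) := abs_of_nonneg (by positivity)
  by_cases hi : i = Fin.last s
  · simp only [couplingTerm, kadetsTerm, hi, if_true, abs_neg, h1, integral_digitIndicator]
    ring
  · simp only [couplingTerm, kadetsTerm, hi, if_false, abs_neg, h1, h2, integral_digitIndicator,
      integral_const, probReal_univ, one_smul]
    ring

lemma norm_seriesElement_inr (i : Fin (s + 1)) (n : ℕ) (m : Fin (n + 1)) (k : Fin (n + 2)) :
    ‖seriesElement ((i, .inr ⟨n, (m, k)⟩) : FamilyIndex s)‖ =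
      2 * (1 / ((n : ℝ) + 1) * (1 / ((n : ℝ) + 2))) := by
  rw [norm_seriesElement_eq]
  have h1 : ∀ z, |digitIndicator (n + 1) k (cubeDigits z) / ((n : ℝ) + 1)| =
      digitIndicator (n + 1) k (cubeDigits z) / ((n : ℝ) + 1) :=
    fun z => abs_of_nonneg (div_nonneg (digitIndicator_mem _ _ _).1 (by positivity))
  have h2 : ∀ z, |digitIndicator n m (cubeDigits z) * digitIndicator (n + 1) k (cubeDigits z)| =
      digitIndicator n m (cubeDigits z) * digitIndicator (n + 1) k (cubeDigits z) :=
    fun z => abs_of_nonneg (mul_nonneg (digitIndicator_mem _ _ _).1 (digitIndicator_mem _ _ _).1)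
  simp only [couplingTerm, kadetsTerm, abs_neg, h1, h2, integral_digitIndicator_mul, integral_div,
    integral_digitIndicator]
  push_cast
  field_simp
  ring

/-- The followers of an `a` have total norm at most that of their leader, namely `2/(n+1)`. -/
lemma sum_norm_block_le (i₀ : Fin (s + 1)) (p : AIndex Cell) :
    ∑ x ∈ block i₀ p, ‖seriesElement x‖ ≤ 4 * (s + 1) * (1 / ((p.1 : ℝ) + 1)) := by
  obtain ⟨n, m⟩ := p
  have h1 : ∀ i, ‖seriesElement ((i, .inl ⟨n, m⟩) : FamilyIndex s)‖ +
      ∑ b ∈ followers i₀ i ⟨n, m⟩, ‖seriesElement ((i, .inr b) : FamilyIndex s)‖ ≤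
      4 * (1 / ((n : ℝ) + 1)) := by
    intro i
    rw [norm_seriesElement_inl]
    have h2 : ∑ b ∈ followers i₀ i ⟨n, m⟩, ‖seriesElement ((i, .inr b) : FamilyIndex s)‖ ≤
        2 * (1 / ((n : ℝ) + 1)) := by
      by_cases hi : i = i₀
      · subst hi
        cases n with
        | zero => rw [sum_followers_zero]; norm_num
        | succ n =>
          rw [sum_followers_succ]
          simp only [norm_seriesElement_inr, Finset.sum_const, Finset.card_univ, Fintype.card_fin,
            nsmul_eq_mul]
          apply le_of_eq
          push_cast
          field_simp
          ring
      · rw [sum_followers_ne hi]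
        simp only [norm_seriesElement_inr, Finset.sum_const, Finset.card_univ, Fintype.card_fin,
          nsmul_eq_mul]
        apply le_of_eq
        push_cast
        field_simp
        ring
    linarith
  rw [sum_block]
  refine (Finset.sum_le_sum fun i _ => h1 i).trans (le_of_eq ?_)
  rw [Finset.sum_const, Finset.card_univ, Fintype.card_fin, nsmul_eq_mul]
  push_cast
  ring

lemma sum_block_seriesElement (i₀ : Fin (s + 1)) (p : AIndex Cell) :
    ∑ x ∈ block i₀ p, seriesElement x =
      if p.1 = 0 then cubewiseConst (limitValue i₀) else 0 := by
  rw [sum_seriesElement]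
  split_ifs with h
  · rw [cubewiseConst]
    congr 1
    funext z
    simp only [seriesTerm, sum_block_term, h, if_true]
  · refine Eq.trans ?_ (Integrable.toL1_zero
      (integrable_zero (CubeUnion (s + 1)) ℝ (cubeUnionMeasure (s + 1))))
    congr 1
    funext z
    simp [seriesTerm, sum_block_term, h]

instance : Infinite (FamilyIndex s) :=
  Infinite.of_injective (fun n => ((0, .inl ⟨n, 0⟩) : FamilyIndex s)) fun n n' h => by
    simp only [Prod.mk.injEq, Sum.inl.injEq, Sigma.mk.injEq] at h
    exact h.2.1

/-- A rearrangement in the standard order which converges to the `i₀`-th point. -/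
theorem exists_standard_rearrangement (i₀ : Fin (s + 1)) : ∃ e : ℕ ≃ FamilyIndex s,
    Tendsto (fun K => ∑ p ∈ initialIndices e K, seriesElement p) atTop
      (𝓝 (cubewiseConst (limitValue i₀))) ∧
    ∀ i, IsBlockArranged Cell (leader i₀ i) (fun p => e.symm (i, .inl p))
      (fun b => e.symm (i, .inr b)) := by
  obtain ⟨t, ht⟩ := exists_lex_enumeration
  let γ : FamilyIndex s → ℕ := fun x => t (blockIndex i₀ x)
  -- Each block is split in two, so that all its `a` come before all its `b`; halving `β` recovers
  -- the block number `γ`.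
  let β : FamilyIndex s → ℕ := fun x => 2 * γ x + Sum.elim (fun _ => 0) (fun _ => 1) x.2
  have hβγ : ∀ x, β x / 2 = γ x := by
    rintro ⟨i, x | x⟩ <;> simp only [β, Sum.elim_inl, Sum.elim_inr] <;> omega
  have hγ : ∀ n x, x ∈ block i₀ (t.symm n) ↔ γ x = n := by
    intro n x
    rw [mem_block, Equiv.eq_symm_apply]
  obtain ⟨e, he⟩ := exists_equiv_nat_monotone β
    (fun n => (block i₀ (t.symm (n / 2))).filter fun x => β x = n) (by
      intro n x
      rw [Finset.mem_filter, hγ, ← hβγ]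
      exact ⟨fun h => h.2, fun h => ⟨by rw [h], h⟩⟩)
  have heγ : Monotone (γ ∘ e) := fun a b hab => by
    have := he hab
    simp only [Function.comp_apply, ← hβγ] at this ⊢
    exact Nat.div_le_div_right this
  have hlt : ∀ x y, β x < β y → e.symm x < e.symm y := by
    intro x y h
    by_contra hc
    have := he (not_lt.1 hc)
    simp only [Function.comp_apply, Equiv.apply_symm_apply] at this
    omega
  refine ⟨e, ?_, fun i => ⟨⟨fun n => inferInstanceAs (LinearOrder (Fin (n + 1))), fun p q => ?_⟩,
    fun b => ⟨?_, fun p hp => ?_⟩⟩⟩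
  · refine tendsto_sum_of_blocks seriesElement γ (fun n => block i₀ (t.symm n)) hγ e heγ ?_ ?_
    -- Level `0` has a single cell, so exactly one block has a nonzero sum, and that sum is the
    -- limit.
    · have h0 : ∀ n, (t.symm n).1 = 0 ↔ n = t ⟨0, 0⟩ := by
        intro n
        rw [← Equiv.symm_apply_eq]
        constructor
        · intro h
          generalize t.symm n = p at h ⊢
          obtain ⟨a, b⟩ := p
          change a = 0 at h
          subst h
          congr 1
          exact Subsingleton.elim (α := Fin 1) _ _
        · intro h
          rw [h]
      simp only [sum_block_seriesElement, h0, Finset.sum_ite_eq', Finset.mem_range]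
      refine tendsto_const_nhds.congr' ?_
      filter_upwards [eventually_gt_atTop (t ⟨0, 0⟩)] with N hN
      rw [if_pos hN]
    · refine squeeze_zero (fun n => Finset.sum_nonneg fun _ _ => norm_nonneg _)
        (fun n => sum_norm_block_le i₀ (t.symm n)) ?_
      rw [← mul_zero (4 * ((s : ℝ) + 1))]
      refine Tendsto.const_mul _ (tendsto_one_div_add_atTop_nhds_zero_nat.comp ?_)
      refine Monotone.tendsto_atTop_atTop (fun a b hab => ?_) fun n => ⟨t ⟨n, 0⟩, by simp⟩
      by_contra hc
      have := (ht (t.symm b) (t.symm a)).2 (by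
        generalize t.symm a = p at *
        generalize t.symm b = q at *
        obtain ⟨_, _⟩ := p
        obtain ⟨_, _⟩ := q
        exact Sigma.Lex.left _ _ (not_le.1 hc))
      simp only [Equiv.apply_symm_apply] at this
      omega
  · rw [← ht]
    have h1 : ∀ p q : AIndex Cell, t p < t q →
        e.symm ((i, .inl p) : FamilyIndex s) < e.symm (i, .inl q) := fun p q h =>
      hlt _ _ (by simpa [β, γ, blockIndex] using h)
    refine ⟨fun h => ?_, h1 p q⟩
    by_contra hc
    rcases (not_lt.1 hc).eq_or_lt with h2 | h2
    · rw [t.injective h2] at h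
      exact lt_irrefl _ h
    · exact absurd h (h1 q p h2).not_gt
  · exact hlt _ _ (by simp [β, γ, blockIndex])
  · have h1 : t (leader i₀ i b) < t p := by
      by_contra hc
      rcases (not_lt.1 hc).eq_or_lt with h2 | h2
      · rw [t.injective h2] at hp
        exact lt_irrefl _ hp
      · exact absurd hp (hlt (i, .inl p) (i, .inl (leader i₀ i b))
          (by simpa [β, γ, blockIndex] using h2)).not_gt
    refine hlt _ _ ?_
    simp only [β, γ, blockIndex, Sum.elim_inl, Sum.elim_inr]
    omega

end StandardOrders

/-! ### Affine independence and the main theorem. -/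

section MainTheorem

variable {s : ℕ}

/-- `cubewiseConst` as a linear map. -/
noncomputable def cubewiseConstLinearMap (N : ℕ) :
    (Fin (N + 1) → ℝ) →ₗ[ℝ] Lp ℝ 1 (cubeUnionMeasure N) where
  toFun := cubewiseConst
  map_add' c c' := Integrable.toL1_add _ _ (integrable_const_fst c) (integrable_const_fst c')
  map_smul' a c := Integrable.toL1_smul _ (integrable_const_fst c) a

lemma cubewiseConst_injective (N : ℕ) :
    Function.Injective (cubewiseConst : (Fin (N + 1) → ℝ) → Lp ℝ 1 (cubeUnionMeasure N)) := by
  refine (injective_iff_map_eq_zero (cubewiseConstLinearMap N)).2 fun c hc => ?_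
  have h1 : ‖cubewiseConst c‖ = 0 := norm_eq_zero.2 hc
  rw [cubewiseConst, norm_toL1_eq_sum] at h1
  simp only [integral_const, probReal_univ, one_smul] at h1
  rw [Finset.sum_eq_zero_iff_of_nonneg fun _ _ => abs_nonneg _] at h1
  funext q
  exact abs_eq_zero.1 (h1 q (Finset.mem_univ q))

/-- On the family cubes the vectors restrict to the standard basis. -/
lemma linearIndependent_limitValue :
    LinearIndependent ℝ (limitValue : Fin (s + 1) → Fin (s + 2) → ℝ) := by
  rw [Fintype.linearIndependent_iff]
  intro g hg i
  have := congrFun hg i.succ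
  simpa [limitValue] using this

lemma linearIndependent_cubewiseConst_limitValue :
    LinearIndependent ℝ (fun i₀ : Fin (s + 1) => cubewiseConst (limitValue i₀)) :=
  linearIndependent_limitValue.map' (cubewiseConstLinearMap (s + 1))
    (LinearMap.ker_eq_bot.2 (cubewiseConst_injective (s + 1)))

lemma sumRange_seriesElement (E : ℕ ≃ FamilyIndex s) :
    sumRange (fun k => seriesElement (E k)) =
      Set.range fun i₀ : Fin (s + 1) => cubewiseConst (limitValue i₀) := by
  ext f
  constructor
  · rintro ⟨σ, hσ⟩
    obtain ⟨i₀, rfl⟩ := exists_eq_cubewiseConst (e := σ.trans E) (f := f) (by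
      simp only [sum_initialIndices]
      exact hσ)
    exact ⟨i₀, rfl⟩
  · rintro ⟨i₀, rfl⟩
    obtain ⟨e, he, -⟩ := exists_standard_rearrangement i₀
    refine ⟨e.trans E.symm, ?_⟩
    simpa [RearrangementConvergesTo, sum_initialIndices] using he

lemma isKadetsFamily_kadetsTerm : IsKadetsFamily Cell
    (fun n m x => kadetsTerm (.inl ⟨n, m⟩) (cubeDigits x))
    (fun n m k x => kadetsTerm (.inr ⟨n, (m, k)⟩) (cubeDigits x)) where
  integrable n m := by
    have h := integrable_term_comp ((0, .inl ⟨n, m⟩) : FamilyIndex 0) (Fin.succ 0)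
    simpa only [term_succ, if_true] using h
  sum_eq_one n x := sum_digitIndicator n _
  norm_eq n m := by
    have h1 : ∀ x, |digitIndicator n m (cubeDigits x)| = digitIndicator n m (cubeDigits x) :=
      fun x => abs_of_nonneg (digitIndicator_mem n m _).1
    simp only [kadetsTerm, h1, integral_digitIndicator, Fintype.card_fin]
    push_cast
    rfl
  card_tendsto := by
    simp only [Fintype.card_fin]
    exact tendsto_add_atTop_nat 1
  depends_only n m x y h := by
    change digitIndicator n m _ = digitIndicator n m _
    unfold digitIndicator cubeDigits
    rw [h]
  zero_or_one n m x := by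
    simp only [kadetsTerm, digitIndicator]
    split_ifs <;> simp
  b_eq n m k x := rfl

end MainTheorem

theorem mainTheorem3 (r : ℕ) (hr : 1 < r) :
    ∃ (N : ℕ) (d : ℕ → CubeUnion N → ℝ)
      (hd : ∀ k, Integrable (d k) (cubeUnionMeasure N))
      (S : Set (Lp ℝ 1 (cubeUnionMeasure N)))
      (M : ℕ → Type) (_ : ∀ n, Fintype (M n))
      (F : AIndex M → ℕ) (G : BIndex M → ℕ),
      -- the sum range in `L¹` consists of exactly `r` affinely independent points
      S = sumRange (fun k => (hd k).toL1 (d k)) ∧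
      S.encard = r ∧
      AffineIndependent ℝ (fun f : S => (f : Lp ℝ 1 (cubeUnionMeasure N))) ∧
      -- two disjoint subfamilies form a Kadets family on the last cube
      Function.Injective F ∧ Function.Injective G ∧
      Disjoint (Set.range F) (Set.range G) ∧
      IsKadetsFamily M
        (fun n m x => d (F ⟨n, m⟩) (Fin.last N, x))
        (fun n m j x => d (G ⟨n, (m, j)⟩) (Fin.last N, x)) ∧
      -- all the other functions vanish on the last cube
      (∀ k, k ∉ Set.range F → k ∉ Set.range G → ∀ x, d k (Fin.last N, x) = 0) ∧
      ∃ p ∈ S,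
        -- one point of the sum range is `1` on the last cube, the others vanish there
        (∀ᵐ z ∂cubeUnionMeasure N, z.1 = Fin.last N → p z = 1) ∧
        (∀ q ∈ S, q ≠ p → ∀ᵐ z ∂cubeUnionMeasure N, z.1 = Fin.last N → q z = 0) ∧
        -- every point of the sum range is the limit of a standard rearrangement
        ∀ q ∈ S, ∃ σ : Equiv.Perm ℕ,
          RearrangementConvergesTo (fun k => (hd k).toL1 (d k)) σ q ∧
          (q = p → IsOneArranged M (fun i => σ.symm (F i)) (fun i => σ.symm (G i))) ∧
          (q ≠ p → IsZeroArranged M (fun i => σ.symm (F i)) (fun i => σ.symm (G i))) := by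
  -- There are `r = s + 1` families and hence `s + 2` cubes; in `CubeUnion (s + 1)` the last cube
  -- `Fin.last (s + 1)` is the one of the last family, which provides `F` and `G`. The point `p` is
  -- the limit with `i₀ = Fin.last s`.
  obtain ⟨s, rfl⟩ : ∃ s, r = s + 1 := ⟨r - 1, by omega⟩
  obtain ⟨E⟩ : Nonempty (ℕ ≃ FamilyIndex s) := nonempty_equiv_of_countable
  let P : Fin (s + 1) → Lp ℝ 1 (cubeUnionMeasure (s + 1)) := fun i₀ => cubewiseConst (limitValue i₀)
  have hP : Function.Injective P := linearIndependent_cubewiseConst_limitValue.injective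
  have hlast : ∀ i₀, ∀ᵐ z ∂cubeUnionMeasure (s + 1), z.1 = Fin.last (s + 1) →
      P i₀ z = if Fin.last s = i₀ then 1 else 0 := by
    intro i₀
    filter_upwards [(integrable_const_fst (limitValue i₀)).coeFn_toL1] with z hz h
    simp only [P, cubewiseConst]
    rw [hz, h, ← Fin.succ_last]
    rfl
  refine ⟨s + 1, fun k => seriesTerm (E k), fun k => integrable_seriesTerm (E k), Set.range P, Cell,
    inferInstance, fun p => E.symm (Fin.last s, .inl p), fun b => E.symm (Fin.last s, .inr b),
    (sumRange_seriesElement E).symm, ?_,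
    linearIndependent_cubewiseConst_limitValue.affineIndependent.range, fun p q h => ?_,
    fun p q h => ?_, ?_, ?_, fun k hF hG x => ?_, P (Fin.last s), ⟨_, rfl⟩, ?_, ?_, ?_⟩
  · rw [← Set.image_univ, hP.encard_image, Set.encard_univ]
    simp
  · simpa using h
  · simpa using h
  · rw [Set.disjoint_left]
    rintro _ ⟨p, rfl⟩ ⟨q, h⟩
    simp at h
  · have h := isKadetsFamily_kadetsTerm
    simpa only [Equiv.apply_symm_apply, seriesTerm, ← Fin.succ_last, term_succ, if_true] using h
  · simp only [seriesTerm, ← Fin.succ_last, term_succ]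
    rw [if_neg]
    intro h
    rcases hk : E k with ⟨i, p | b⟩ <;> rw [hk] at h
    · exact hF ⟨p, by rw [Equiv.symm_apply_eq, hk, h]⟩
    · exact hG ⟨b, by rw [Equiv.symm_apply_eq, hk, h]⟩
  · simpa using hlast (Fin.last s)
  · rintro _ ⟨i₀, rfl⟩ hne
    have : Fin.last s ≠ i₀ := fun h => hne (by rw [h])
    simpa [this] using hlast i₀
  · rintro _ ⟨i₀, rfl⟩
    obtain ⟨e, he, hb⟩ := exists_standard_rearrangement i₀
    refine ⟨e.trans E.symm, ?_, fun h => ?_, fun h => ?_⟩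
    · have : ∀ K, ∑ k ∈ Finset.range K, (integrable_seriesTerm (E ((e.trans E.symm) k))).toL1
          (seriesTerm (E ((e.trans E.symm) k))) = ∑ p ∈ initialIndices e K, seriesElement p := by
        intro K
        simp [sum_initialIndices, seriesElement]
      simpa only [RearrangementConvergesTo, this] using he
    · have hi : Fin.last s = i₀ := (hP h).symm
      have h1 := hb (Fin.last s)
      have h2 : leader i₀ (Fin.last s) = fun b : BIndex Cell => ⟨b.1 + 1, b.2.2⟩ := by
        funext b
        rw [leader, if_pos hi]
      rw [h2] at h1
      simpa [IsOneArranged] using h1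
    · have hi : Fin.last s ≠ i₀ := fun hi => h (by rw [hi])
      have h1 := hb (Fin.last s)
      have h2 : leader i₀ (Fin.last s) = fun b : BIndex Cell => ⟨b.1, b.2.1⟩ := by
        funext b
        rw [leader, if_neg hi]
      rw [h2] at h1
      simpa [IsZeroArranged] using h1
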